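/- Let $k=\mathbb{Q}$ or $k=\mathbb{Z}/p\mathbb{Z}$ for a prime $p$, let $n\ge 0$ and $i\ge 1$ be integers. Regard $\mathbb{R}^n$ as a poset, hence a category, with the coordinatewise order. An *$n$-module* is a functor $M$ from $\mathbb{R}^n$ to the category of $k$-vector spaces; write $\varphi_M(a,b):M_a\to M_b$ for its transition maps ($a\le b$), and for $\epsilon\ge 0$ let $M(\epsilon)$ be the $n$-module with $M(\epsilon)_a=M_{a+(\epsilon,\dots,\epsilon)}$. Two $n$-modules $M,N$ are *$\epsilon$-interleaved* if there are morphisms (natural transformations) $f:M\to N(\epsilon)$ and $g:N\to M(\epsilon)$ such that $g(\epsilon)\circ f:M\to M(2\epsilon)$ and $f(\epsilon)\circ g:N\to N(2\epsilon)$ are the morphisms given by the transition maps $\varphi_M(a,a+(2\epsilon,\dots,2\epsilon))$ and $\varphi_N(a,a+(2\epsilon,\dots,2\epsilon))$. The *interleaving distance* is $d_I(M,N)=\inf\{\epsilon\in[0,\infty) : M,N \text{ are } \epsilon\text{-interleaved}\}\in[0,\infty]$ (with $\inf\emptyset=\infty$); it depends only on the isomorphism classes of $M$ and $N$. For a topological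 space $X$ and a (not necessarily continuous) function $\gamma:X\to\mathbb{R}^n$, let $H_i(\gamma)$ be the $n$-module $a\mapsto H_i(\{x\in X:\gamma(x)\le a\};k)$ (singular homology with coefficients in $k$), whose transition maps are induced by the inclusions. A *pseudometric* is a function $d$ into $[0,\infty]$ with $d(x,x)=0$, $d(x,y)=d(y,x)$ and $d(x,z)\le d(x,y)+d(y,z)$. A pseudometric $d$ on the isomorphism classes of $n$-modules is *$i$-stable* if for every topological space $X$ and all functions $\gamma_1,\gamma_2:X\to\mathbb{R}^n$, $$d\big(H_i(\gamma_1),H_i(\gamma_2)\big)\le\|\gamma_1-\gamma_2\|_\infty=\sup_{x\in X}\max_{1\le j\le n}|\gamma_1(x)_j-\gamma_2(x)_j|.$$ Then $d_I$ is *$i$-optimal*: it is an $i$-stable pseudometric on isomorphism classes of $n$-modules, and every $i$-stable pseudometric $d'$ on isomorphism classes of $n$-modules satisfies $d'(M,N)\le d_I(M,N)$ for all $n$-modules $M,N$. -/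

import Mathlib

open CategoryTheory
open scoped NNReal ENNReal

noncomputable section

namespace Persistence

/-- The poset `ℝⁿ` with the coordinatewise order. (It is a separate type so that it is made into
a category by its order and not as a product of categories.) -/
def Grade (n : ℕ) : Type := Fin n → ℝ

instance instPartialOrderGrade (n : ℕ) : PartialOrder (Grade n) :=
  inferInstanceAs (PartialOrder (Fin n → ℝ))

/-- The category of `n`-modules over `k`: functors from the poset `ℝⁿ` (with the coordinatewise
order) to `k`-vector spaces. -/
abbrev NMod (k : Type) [Field k] (n : ℕ) : Type 1 :=
  Grade n ⥤ ModuleCat.{0} k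

/-- Isomorphism classes of `n`-modules. -/
abbrev NModClass (k : Type) [Field k] (n : ℕ) : Type 1 :=
  Quotient (isIsomorphicSetoid (NMod k n))

/-- The isomorphism class of an `n`-module. -/
def NMod.cls {k : Type} [Field k] {n : ℕ} (M : NMod k n) : NModClass k n :=
  Quotient.mk (isIsomorphicSetoid (NMod k n)) M

/-- Translation of `ℝⁿ` by `(ε, …, ε)`, as an endofunctor of the poset category. -/
def translation (n : ℕ) (ε : ℝ≥0) : Grade n ⥤ Grade n :=
  Monotone.functor (f := fun (a : Grade n) => (fun j => a j + (ε : ℝ) : Grade n))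
    (fun _ _ h j => add_le_add (h j) le_rfl)

theorem le_translation {n : ℕ} (ε : ℝ≥0) (a : Grade n) : a ≤ (translation n ε).obj a :=
  fun j => le_add_of_nonneg_right (a := a j) ε.coe_nonneg

/-- The shifted module `M(ε)`, with `M(ε)_a = M_{a + (ε, …, ε)}`. -/
abbrev NMod.shift {k : Type} [Field k] {n : ℕ} (M : NMod k n) (ε : ℝ≥0) : NMod k n :=
  translation n ε ⋙ M

/-- `M` and `N` are `ε`-interleaved: there are morphisms `f : M ⟶ N(ε)` and `g : N ⟶ M(ε)` such
that `g(ε) ∘ f` and `f(ε) ∘ g` are the transition morphisms `M ⟶ M(2ε)` and `N ⟶ N(2ε)`. -/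
def Interleaved {k : Type} [Field k] {n : ℕ} (ε : ℝ≥0) (M N : NMod k n) : Prop :=
  ∃ (f : M ⟶ N.shift ε) (g : N ⟶ M.shift ε),
    (∀ a : Grade n, f.app a ≫ g.app ((translation n ε).obj a) =
      M.map (homOfLE ((le_translation ε a).trans (le_translation ε _)))) ∧
    (∀ a : Grade n, g.app a ≫ f.app ((translation n ε).obj a) =
      N.map (homOfLE ((le_translation ε a).trans (le_translation ε _))))

theorem Interleaved.of_iso {k : Type} [Field k] {n : ℕ} {ε : ℝ≥0} {M N M' N' : NMod k n}
    (u : M ≅ M') (v : N ≅ N') (h : Interleaved ε M N) : Interleaved ε M' N' := by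
  obtain ⟨f, g, hfg, hgf⟩ := h
  refine ⟨u.inv ≫ f ≫ Functor.whiskerLeft (translation n ε) v.hom,
    v.inv ≫ g ≫ Functor.whiskerLeft (translation n ε) u.hom, fun a => ?_, fun a => ?_⟩
  · have := hfg a
    simp only [NatTrans.comp_app, Functor.whiskerLeft_app, Category.assoc,
      Iso.hom_inv_id_app_assoc]
    rw [reassoc_of% this, u.hom.naturality, Iso.inv_hom_id_app_assoc]
  · have := hgf a
    simp only [NatTrans.comp_app, Functor.whiskerLeft_app, Category.assoc,
      Iso.hom_inv_id_app_assoc]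
    rw [reassoc_of% this, v.hom.naturality, Iso.inv_hom_id_app_assoc]

/-- The interleaving distance on `n`-modules: the infimum of all `ε ∈ [0, ∞)` such that `M` and
`N` are `ε`-interleaved (and `∞` if there are none). -/
def interleavingDistMod {k : Type} [Field k] {n : ℕ} (M N : NMod k n) : ℝ≥0∞ :=
  ⨅ (ε : ℝ≥0) (_ : Interleaved ε M N), (ε : ℝ≥0∞)

/-- The interleaving distance on isomorphism classes of `n`-modules. -/
def interleavingDist (k : Type) [Field k] (n : ℕ) (x y : NModClass k n) : ℝ≥0∞ :=
  Quotient.liftOn₂ x y interleavingDistMod (by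
    rintro M N M' N' ⟨u⟩ ⟨v⟩
    have h : ∀ ε : ℝ≥0, Interleaved ε M N ↔ Interleaved ε M' N' := fun ε =>
      ⟨Interleaved.of_iso u v, Interleaved.of_iso u.symm v.symm⟩
    simp only [interleavingDistMod, h])

/-- The sublevelset filtration of a (not necessarily continuous) function `γ : X → ℝⁿ`: the space
at index `a` is the subspace `{x | γ x ≤ a}`, and the transition maps are the inclusions. -/
def sublevelFiltration {n : ℕ} (X : Type) [TopologicalSpace X] (γ : X → Fin n → ℝ) :
    Grade n ⥤ TopCat.{0} where
  obj a := TopCat.of {x : X // ∀ j, γ x j ≤ a j}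
  map {a b} h := TopCat.ofHom
    { toFun := fun x => ⟨x.1, fun j => (x.2 j).trans (leOfHom h j)⟩
      continuous_toFun := continuous_subtype_val.subtype_mk _ }

/-- The `i`-th persistent singular homology module, with coefficients in `k`, of the
sublevelset filtration of `γ : X → ℝⁿ`. -/
def sublevelHomology (k : Type) [Field k] {n : ℕ} (i : ℕ) (X : Type) [TopologicalSpace X]
    (γ : X → Fin n → ℝ) : NMod k n :=
  sublevelFiltration X γ ⋙
    (AlgebraicTopology.singularHomologyFunctor (ModuleCat.{0} k) i).obj (ModuleCat.of k k)

/-- The sup-norm distance `‖γ₁ - γ₂‖_∞ = sup_x max_j |γ₁(x)_j - γ₂(x)_j| ∈ [0, ∞]` (the distance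
of `Fin n → ℝ` is that of the max-norm). -/
def supDist {n : ℕ} {X : Type} (γ₁ γ₂ : X → Fin n → ℝ) : ℝ≥0∞ :=
  ⨆ x : X, edist (γ₁ x) (γ₂ x)

/-- Extended pseudometrics, i.e. pseudometrics with values in `[0, ∞]`. -/
structure IsExtPseudometric {S : Type*} (d : S → S → ℝ≥0∞) : Prop where
  self : ∀ x, d x x = 0
  symm : ∀ x y, d x y = d y x
  triangle : ∀ x y z, d x z ≤ d x y + d y z

/-- `i`-stability of a distance on isomorphism classes of `n`-modules. -/
def IsStable (k : Type) [Field k] (n i : ℕ) (d : NModClass k n → NModClass k n → ℝ≥0∞) : Prop :=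
  ∀ (X : Type) [TopologicalSpace X] (γ₁ γ₂ : X → Fin n → ℝ),
    d (sublevelHomology k i X γ₁).cls (sublevelHomology k i X γ₂).cls ≤ supDist γ₁ γ₂

/-- `d` is an `i`-optimal pseudometric (for `i ≥ 1`): it is an `i`-stable pseudometric, and every
`i`-stable pseudometric is bounded above by it. -/
structure IsOptimal (k : Type) [Field k] (n i : ℕ)
    (d : NModClass k n → NModClass k n → ℝ≥0∞) : Prop where
  pseudometric : IsExtPseudometric d
  stable : IsStable k n i d
  maximal : ∀ d' : NModClass k n → NModClass k n → ℝ≥0∞,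
    IsExtPseudometric d' → IsStable k n i d' → ∀ x y, d' x y ≤ d x y

end Persistence

end

/-! Stability is formal. If `γ₁` and `γ₂` differ by at most `ε`, the sublevel set of either one at
`a` lies in that of the other at `a + ε`, and homology turns these inclusions into an
`ε`-interleaving. The triangle inequality comes from composing interleavings.

Maximality needs a geometric realization (`Interleaved.exists_sublevelHomology_iso`): if `M` and `N`
are `ε`-interleaved, then one space carries two functions at distance at most `ε` whose homology
modules are `M` and `N`. Every stable `d'` then satisfies `d' M N ≤ ε`, and it remains to take the
infimum over `ε`.

For the realization, an interleaving is read as one functor to vector spaces from two copies of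
`ℝⁿ`, where `a` lies below `b` in the other copy iff `a + ε ≤ b`. It is composed with a functor `F`
from vector spaces to spaces satisfying `H_i ∘ F ≅ id`. The spaces of the resulting diagram are
placed side by side, with a topology in which every neighbourhood of the image of a point under a
transition map contains the point. The part below an index `q` then deforms onto the space at `q`.
The two functions record from which grade on a point lies below the first, respectively the second,
copy; they differ by at most `ε`, and their sublevel sets have the homology of `M` and `N`.

In degree 1, `F` sends `A` to the quotient of a contractible-like infinite join by the free action
of the group `A`. Its first homology is `A ⊗ k`, which is `A` itself because additive maps between
vector spaces over `ℚ` or `ℤ/p` are linear (`AdditivelyRigid`). The identification integrates edges: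
lift to the join and subtract endpoint labels. Higher degrees follow by suspension, whose
isomorphism in homology rests on the small simplices theorem, hence on barycentric subdivision.

The join, the suspension and the total space are non-Hausdorff on purpose: in such topologies
comparable maps are homotopic (`ContinuousMap.homotopic_of_specializes`), which makes cones and
retractions explicit and strictly functorial. -/

noncomputable section

/-! ### Singular chains as finitely supported functions. -/

namespace SingularChains

open AlgebraicTopology Simplicial

/-- The standard topological `n`-simplex. -/
abbrev Splx (n : ℕ) : Type := stdSimplex ℝ (Fin (n + 1))

/-- The inclusion of the `i`-th face of the standard simplex. -/
def face {n : ℕ} (i : Fin (n + 2)) : C(Splx n, Splx (n + 1)) :=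
  ⟨stdSimplex.map i.succAbove, stdSimplex.continuous_map _⟩

/-- Singular `n`-chains with coefficients in `k`, as finitely supported functions. -/
abbrev Ch (k : Type) [Field k] (X : Type) [TopologicalSpace X] (n : ℕ) : Type :=
  C(Splx n, X) →₀ k

section

variable (k : Type) [Field k] {X Y : Type} [TopologicalSpace X] [TopologicalSpace Y]

/-- The boundary map on singular chains. -/
def bdry (X : Type) [TopologicalSpace X] (n : ℕ) : Ch k X (n + 1) →ₗ[k] Ch k X n :=
  ∑ i : Fin (n + 2), ((-1) ^ (i : ℕ) : k) •
    Finsupp.lmapDomain k k fun σ : C(Splx (n + 1), X) => σ.comp (face i)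

/-- The map on singular chains induced by a continuous map. -/
def push (f : C(X, Y)) (n : ℕ) : Ch k X n →ₗ[k] Ch k Y n :=
  Finsupp.lmapDomain k k fun σ => f.comp σ

@[simp]
theorem bdry_single (n : ℕ) (σ : C(Splx (n + 1), X)) (r : k) :
    bdry k X n (Finsupp.single σ r) =
      ∑ i : Fin (n + 2), ((-1) ^ (i : ℕ) : k) • Finsupp.single (σ.comp (face i)) r := by
  simp [bdry, LinearMap.sum_apply]

@[simp]
theorem push_single (f : C(X, Y)) (n : ℕ) (σ : C(Splx n, X)) (r : k) :
    push k f n (Finsupp.single σ r) = Finsupp.single (f.comp σ) r := by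
  simp [push]

theorem push_bdry (f : C(X, Y)) (n : ℕ) (c : Ch k X (n + 1)) :
    push k f n (bdry k X n c) = bdry k Y n (push k f (n + 1) c) := by
  have : push k f n ∘ₗ bdry k X n = bdry k Y n ∘ₗ push k f (n + 1) := by
    ext σ : 2
    simp [ContinuousMap.comp_assoc]
  exact LinearMap.congr_fun this c

/-- Mathlib's singular chain complex. -/
abbrev singularComplex (X : TopCat.{0}) : ChainComplex (ModuleCat.{0} k) ℕ :=
  (TopCat.toSSet.obj X).chainComplex (ModuleCat.of k k)

/-- The map on Mathlib's singular chain complexes induced by a continuous map. -/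
abbrev singularMap {X Y : TopCat.{0}} (f : X ⟶ Y) : singularComplex k X ⟶ singularComplex k Y :=
  SSet.chainComplexMap (TopCat.toSSet.map f) (ModuleCat.of k k)

/-- The singular homology functor in degree `n`. -/
abbrev singH (n : ℕ) : TopCat.{0} ⥤ ModuleCat.{0} k :=
  (singularHomologyFunctor (ModuleCat.{0} k) n).obj (ModuleCat.of k k)

/-- Singular simplices of `TopCat.toSSet` as continuous maps. -/
def simplexEquiv (X : TopCat.{0}) (n : ℕ) :
    (TopCat.toSSet.obj X) _⦋n⦌ ≃ C(Splx n, X) :=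
  X.toSSetObjEquiv (Opposite.op ⦋n⦌)

theorem simplexEquiv_δ (X : TopCat.{0}) (n : ℕ) (i : Fin (n + 2))
    (x : (TopCat.toSSet.obj X) _⦋n + 1⦌) :
    simplexEquiv X n ((TopCat.toSSet.obj X).δ i x) = (simplexEquiv X (n + 1) x).comp (face i) :=
  rfl

theorem simplexEquiv_map {X Y : TopCat.{0}} (f : X ⟶ Y) (n : ℕ)
    (x : (TopCat.toSSet.obj X) _⦋n⦌) :
    simplexEquiv Y n ((TopCat.toSSet.map f).app _ x) = f.hom.comp (simplexEquiv X n x) :=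
  rfl

/-- Comparison of Mathlib's singular chains with finitely supported functions. -/
def toCh (X : TopCat.{0}) (n : ℕ) : (singularComplex k X).X n ⟶ ModuleCat.of k (Ch k X n) :=
  Limits.Sigma.desc fun x => ModuleCat.ofHom (Finsupp.lsingle (simplexEquiv X n x))

theorem ι_toCh (X : TopCat.{0}) (n : ℕ) (x : (TopCat.toSSet.obj X) _⦋n⦌) :
    (TopCat.toSSet.obj X).ιChainComplex (R := ModuleCat.of k k) x ≫ toCh k X n =
      ModuleCat.ofHom (Finsupp.lsingle (simplexEquiv X n x)) :=
  Limits.Sigma.ι_desc _ _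

/-- Comparison of finitely supported functions with Mathlib's singular chains. -/
def ofCh (X : TopCat.{0}) (n : ℕ) : ModuleCat.of k (Ch k X n) ⟶ (singularComplex k X).X n :=
  ModuleCat.ofHom (Finsupp.lsum k fun σ =>
    ((TopCat.toSSet.obj X).ιChainComplex (R := ModuleCat.of k k)
      ((simplexEquiv X n).symm σ)).hom)

theorem single_ofCh (X : TopCat.{0}) (n : ℕ) (σ : C(Splx n, X)) :
    ModuleCat.ofHom (Finsupp.lsingle σ) ≫ ofCh k X n =
      (TopCat.toSSet.obj X).ιChainComplex ((simplexEquiv X n).symm σ) := by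
  ext
  change Finsupp.lsum k _ (Finsupp.single σ (1 : k)) = _
  simp

/-- The comparison isomorphism on chains. -/
def chIso (X : TopCat.{0}) (n : ℕ) : (singularComplex k X).X n ≅ ModuleCat.of k (Ch k X n) where
  hom := toCh k X n
  inv := ofCh k X n
  hom_inv_id := by
    apply SSet.chainComplex_hom_ext
    intro x
    rw [← Category.assoc, ι_toCh, single_ofCh, Equiv.symm_apply_apply, Category.comp_id]
  inv_hom_id := by
    ext1
    refine Finsupp.lhom_ext' fun σ => ?_
    have h := (single_ofCh k X n σ =≫ toCh k X n).trans (ι_toCh k X n _)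
    rw [Category.assoc, Equiv.apply_symm_apply] at h
    exact congrArg ModuleCat.Hom.hom h

/-- With `chIso_map`, this makes the degreewise isomorphisms a natural isomorphism of complexes, so
that homology can be computed with explicit chains. -/
theorem chIso_d (X : TopCat.{0}) (n : ℕ) :
    (singularComplex k X).d (n + 1) n ≫ (chIso k X n).hom =
      (chIso k X (n + 1)).hom ≫ ModuleCat.ofHom (bdry k X n) := by
  apply SSet.chainComplex_hom_ext
  intro x
  rw [← Category.assoc, ← Category.assoc]
  change (_ ≫ _) ≫ toCh k X n = (_ ≫ toCh k X (n + 1)) ≫ _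
  rw [ι_toCh, SSet.ιChainComplex_d, Preadditive.sum_comp]
  simp only [Preadditive.zsmul_comp, ι_toCh, simplexEquiv_δ]
  ext
  simp

theorem chIso_map {X Y : TopCat.{0}} (f : X ⟶ Y) (n : ℕ) :
    (singularMap k f).f n ≫
      (chIso k Y n).hom = (chIso k X n).hom ≫ ModuleCat.ofHom (push k f.hom n) := by
  apply SSet.chainComplex_hom_ext
  intro x
  rw [← Category.assoc, ← Category.assoc]
  change (_ ≫ _) ≫ toCh k Y n = (_ ≫ toCh k X n) ≫ _
  rw [ι_toCh, SSet.ι_chainComplexMap_f, ι_toCh]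
  ext
  simp [simplexEquiv_map]

end

/-! ### Homology classes in a complex of modules. -/

section

variable {k : Type} [Field k] (K : ChainComplex (ModuleCat.{0} k) ℕ) (n : ℕ)

/-- Cycles of a complex of modules, as elements of the abstract module of cycles. -/
def mkCycles : ModuleCat.of k (LinearMap.ker (K.d (n + 1) n).hom) ⟶ K.cycles (n + 1) :=
  K.liftCycles (ModuleCat.ofHom (LinearMap.ker (K.d (n + 1) n).hom).subtype) n
    (ChainComplex.next_nat_succ n) (by ext x; exact x.2)

theorem iCycles_mkCycles (z : LinearMap.ker (K.d (n + 1) n).hom) :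
    (K.iCycles (n + 1)).hom ((mkCycles K n).hom z) = z :=
  congr(($(K.liftCycles_i (ModuleCat.ofHom (LinearMap.ker (K.d (n + 1) n).hom).subtype) n
    (ChainComplex.next_nat_succ n) (by ext x; exact x.2))).hom z)

theorem iCycles_injective : Function.Injective (K.iCycles (n + 1)).hom :=
  (ModuleCat.mono_iff_injective (K.iCycles (n + 1))).1 inferInstance

/-- The homology class of a cycle in a complex of modules. -/
def homologyClass : LinearMap.ker (K.d (n + 1) n).hom →ₗ[k] K.homology (n + 1) :=
  (mkCycles K n ≫ K.homologyπ (n + 1)).hom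

theorem mkCycles_surjective : Function.Surjective (mkCycles K n).hom := fun c =>
  ⟨⟨(K.iCycles (n + 1)).hom c, congr(($(K.iCycles_d (n + 1) n)).hom c)⟩,
    iCycles_injective K n (iCycles_mkCycles K n _)⟩

theorem homologyClass_surjective : Function.Surjective (homologyClass K n) :=
  ((ModuleCat.epi_iff_surjective (K.homologyπ (n + 1))).1 inferInstance).comp
    (mkCycles_surjective K n)

/-- Homology is the cokernel of the map from chains to cycles, and cycles embed in chains; exactness
at the cycles is the claim. -/
theorem homologyClass_eq_zero_iff (z : LinearMap.ker (K.d (n + 1) n).hom) :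
    homologyClass K n z = 0 ↔ ∃ w, (K.d (n + 2) (n + 1)).hom w = z := by
  have hex := ShortComplex.exact_of_g_is_cokernel
    (ShortComplex.mk (K.toCycles (n + 2) (n + 1)) (K.homologyπ (n + 1)) (by simp))
    (K.homologyIsCokernel (n + 2) (n + 1) (ChainComplex.prev ℕ (n + 1)))
  rw [ShortComplex.moduleCat_exact_iff] at hex
  have ht (w) : (K.iCycles (n + 1)).hom ((K.toCycles (n + 2) (n + 1)).hom w) =
      (K.d (n + 2) (n + 1)).hom w := congr(($(K.toCycles_i (n + 2) (n + 1))).hom w)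
  constructor
  · intro h
    obtain ⟨w, hw⟩ := hex _ h
    exact ⟨w, (ht w).symm.trans
      ((congrArg (K.iCycles (n + 1)).hom hw).trans (iCycles_mkCycles K n z))⟩
  · rintro ⟨w, hw⟩
    have h1 : (K.toCycles (n + 2) (n + 1)).hom w = (mkCycles K n).hom z :=
      iCycles_injective K n ((ht w).trans (hw.trans (iCycles_mkCycles K n z).symm))
    have h2 := congr(($(K.toCycles_comp_homologyπ (n + 2) (n + 1))).hom w)
    exact (congrArg (K.homologyπ (n + 1)).hom h1).symm.trans h2

theorem homologyClass_map {K L : ChainComplex (ModuleCat.{0} k) ℕ} (f : K ⟶ L) (n : ℕ)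
    (z : LinearMap.ker (K.d (n + 1) n).hom) (z' : LinearMap.ker (L.d (n + 1) n).hom)
    (h : (f.f (n + 1)).hom z = z') :
    (HomologicalComplex.homologyMap f (n + 1)).hom (homologyClass K n z) =
      homologyClass L n z' := by
  have h2 : (HomologicalComplex.cyclesMap f (n + 1)).hom ((mkCycles K n).hom z) =
      (mkCycles L n).hom z' := by
    apply iCycles_injective L n
    have h5 := congr(($(HomologicalComplex.cyclesMap_i f (n + 1))).hom ((mkCycles K n).hom z))
    exact h5.trans ((congrArg (f.f (n + 1)).hom (iCycles_mkCycles K n z)).trans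
      (h.trans (iCycles_mkCycles L n z').symm))
  exact (congr(($(HomologicalComplex.homologyπ_naturality f (n + 1))).hom _)).trans
    (congrArg (L.homologyπ (n + 1)).hom h2)

end

/-! ### Homology classes of explicit singular cycles. -/

section

variable (k : Type) [Field k]

/-- The singular cycles of degree `n + 1`. -/
abbrev Cyc (X : Type) [TopologicalSpace X] (n : ℕ) : Submodule k (Ch k X (n + 1)) :=
  LinearMap.ker (bdry k X n)

/-- Cycles of finitely supported functions as cycles of Mathlib's complex. -/
def cycEquiv (X : TopCat.{0}) (n : ℕ) :
    Cyc k X n ≃ₗ[k] LinearMap.ker ((singularComplex k X).d (n + 1) n).hom :=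
  (chIso k X (n + 1)).symm.toLinearEquiv.ofSubmodules _ _ (by
    ext x
    have hd (y) := congr(($(chIso_d k X n)).hom y)
    constructor
    · rintro ⟨y, hy, rfl⟩
      apply (chIso k X n).toLinearEquiv.injective
      have h := hd ((chIso k X (n + 1)).inv.hom y)
      have h' := congr(($((chIso k X (n + 1)).inv_hom_id)).hom y)
      refine h.trans ((congrArg (bdry k X n) h').trans ?_)
      exact (LinearMap.mem_ker.1 hy).trans (map_zero _).symm
    · intro hx
      refine ⟨(chIso k X (n + 1)).hom.hom x, ?_, (chIso k X (n + 1)).toLinearEquiv.symm_apply_apply x⟩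
      exact (hd x).symm.trans ((congrArg (chIso k X n).hom.hom hx).trans (map_zero _)))

/-- The homology class of a singular cycle. -/
def cls (X : TopCat.{0}) (n : ℕ) : Cyc k X n →ₗ[k] (singH k (n + 1)).obj X :=
  homologyClass (singularComplex k X) n ∘ₗ (cycEquiv k X n).toLinearMap

theorem cls_surjective (X : TopCat.{0}) (n : ℕ) : Function.Surjective (cls k X n) :=
  (homologyClass_surjective _ n).comp (cycEquiv k X n).surjective

/-- Together with `cls_surjective` and `cls_naturality`, this reduces the suspension isomorphism and
the computation of first homology to explicit cycles and boundaries. -/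
theorem cls_eq_zero_iff (X : TopCat.{0}) (n : ℕ) (z : Cyc k X n) :
    cls k X n z = 0 ↔ ∃ w, bdry k X (n + 1) w = z := by
  refine (homologyClass_eq_zero_iff _ n _).trans ?_
  have hd (y) := congr(($(chIso_d k X (n + 1))).hom y)
  have hz : (chIso k X (n + 1)).hom.hom (cycEquiv k X n z : (singularComplex k X).X (n + 1)) = z :=
    (chIso k X (n + 1)).toLinearEquiv.apply_symm_apply _
  constructor
  · rintro ⟨w, hw⟩
    exact ⟨(chIso k X (n + 2)).hom.hom w,
      (hd w).symm.trans ((congrArg (chIso k X (n + 1)).hom.hom hw).trans hz)⟩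
  · rintro ⟨w, hw⟩
    refine ⟨(chIso k X (n + 2)).inv.hom w, (chIso k X (n + 1)).toLinearEquiv.injective ?_⟩
    have h' := congr(($((chIso k X (n + 2)).inv_hom_id)).hom w)
    exact (hd _).trans ((congrArg (bdry k X (n + 1)) h').trans (hw.trans hz.symm))

/-- The map on singular cycles induced by a continuous map. -/
def pushCyc {X Y : Type} [TopologicalSpace X] [TopologicalSpace Y] (f : C(X, Y)) (n : ℕ) :
    Cyc k X n →ₗ[k] Cyc k Y n :=
  (push k f (n + 1)).restrict fun z hz => by
    rw [LinearMap.mem_ker] at hz ⊢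
    rw [← push_bdry, hz, map_zero]

theorem cls_naturality {X Y : TopCat.{0}} (f : X ⟶ Y) (n : ℕ) (z : Cyc k X n) :
    ((singH k (n + 1)).map f).hom (cls k X n z) = cls k Y n (pushCyc k f.hom n z) := by
  refine homologyClass_map (singularMap k f) n _ _ ?_
  apply (chIso k Y (n + 1)).toLinearEquiv.injective
  have h := congr(($(chIso_map k f (n + 1))).hom ((cycEquiv k X n z :)))
  have hz : (chIso k X (n + 1)).hom.hom (cycEquiv k X n z : (singularComplex k X).X (n + 1)) = z :=
    (chIso k X (n + 1)).toLinearEquiv.apply_symm_apply _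
  have hz' : (chIso k Y (n + 1)).hom.hom (cycEquiv k Y n (pushCyc k f.hom n z) :
      (singularComplex k Y).X (n + 1)) = pushCyc k f.hom n z :=
    (chIso k Y (n + 1)).toLinearEquiv.apply_symm_apply _
  exact h.trans ((congrArg (push k f.hom (n + 1)) hz).trans hz'.symm)

end

end SingularChains

/-! ### Ordered chains: cones and formal subdivision. -/

namespace OrderedChains

/-- Ordered chains on `q` vertices in a set `V`, augmented by the empty tuple. -/
abbrev LC (k : Type) [Field k] (V : Type) (q : ℕ) : Type := (Fin q → V) →₀ k

variable (k : Type) [Field k] {V W : Type}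

/-- The boundary of ordered chains. -/
def lbd (V : Type) (q : ℕ) : LC k V (q + 1) →ₗ[k] LC k V q :=
  ∑ i : Fin (q + 1), ((-1) ^ (i : ℕ) : k) •
    Finsupp.lmapDomain k k fun v : Fin (q + 1) → V => v ∘ i.succAbove

/-- The cone of ordered chains with a given apex. -/
def lcone (p : V) (q : ℕ) : LC k V q →ₗ[k] LC k V (q + 1) :=
  Finsupp.lmapDomain k k fun v => (Fin.cons p v : Fin (q + 1) → V)

/-- The map on ordered chains induced by a map of vertices. -/
def lmap (f : V → W) (q : ℕ) : LC k V q →ₗ[k] LC k W q :=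
  Finsupp.lmapDomain k k fun v => f ∘ v

@[simp]
theorem lbd_single (q : ℕ) (v : Fin (q + 1) → V) (r : k) :
    lbd k V q (Finsupp.single v r) =
      ∑ i : Fin (q + 1), ((-1) ^ (i : ℕ) : k) • Finsupp.single (v ∘ i.succAbove) r := by
  simp [lbd, LinearMap.sum_apply]

@[simp]
theorem lcone_single (p : V) (q : ℕ) (v : Fin q → V) (r : k) :
    lcone k p q (Finsupp.single v r) = Finsupp.single (Fin.cons p v : Fin (q + 1) → V) r := by
  simp [lcone]

@[simp]
theorem lmap_single (f : V → W) (q : ℕ) (v : Fin q → V) (r : k) :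
    lmap k f q (Finsupp.single v r) = Finsupp.single (f ∘ v) r := by
  simp [lmap]

/-- The bottom case of the cone formula: the empty tuple has no boundary, so there is no second
term. -/
theorem lbd_lcone_zero (p : V) (c : LC k V 0) : lbd k V 0 (lcone k p 0 c) = c := by
  have : lbd k V 0 ∘ₗ lcone k p 0 = LinearMap.id := by
    refine Finsupp.lhom_ext fun v r => ?_
    simp only [LinearMap.comp_apply, lcone_single, lbd_single]
    simp [Subsingleton.elim _ v]
  exact LinearMap.congr_fun this c

theorem cons_comp_succAbove (p : V) {q : ℕ} (v : Fin (q + 1) → V) (j : Fin (q + 1)) :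
    (Fin.cons p v : Fin (q + 2) → V) ∘ j.succ.succAbove =
      (Fin.cons p (v ∘ j.succAbove) : Fin (q + 1) → V) := by
  funext i
  refine Fin.cases ?_ (fun i => ?_) i <;> simp

/-- Omitting the apex returns the chain; omitting any other vertex keeps the apex and shifts the
sign by one. -/
theorem lbd_lcone (p : V) (q : ℕ) (c : LC k V (q + 1)) :
    lbd k V (q + 1) (lcone k p (q + 1) c) = c - lcone k p q (lbd k V q c) := by
  have : lbd k V (q + 1) ∘ₗ lcone k p (q + 1) =
      LinearMap.id - lcone k p q ∘ₗ lbd k V q := by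
    refine Finsupp.lhom_ext fun v r => ?_
    simp only [LinearMap.comp_apply, lcone_single, lbd_single, LinearMap.sub_apply,
      LinearMap.id_apply, map_sum, map_smul]
    rw [Fin.sum_univ_succ]
    simp only [cons_comp_succAbove, Fin.val_zero, pow_zero, one_smul, Fin.val_succ, pow_succ,
      mul_neg, mul_one, neg_smul, Finset.sum_neg_distrib, sub_eq_add_neg]
    congr 2
  exact LinearMap.congr_fun this c

/-- Every tuple is the cone on its tail with apex its first vertex, so induction with the cone
formula replaces the usual cancellation of double faces. -/
theorem lbd_lbd (q : ℕ) (c : LC k V (q + 2)) : lbd k V q (lbd k V (q + 1) c) = 0 := by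
  have : lbd k V q ∘ₗ lbd k V (q + 1) = 0 := by
    clear c
    refine Finsupp.lhom_ext fun v r => ?_
    induction q with
    | zero =>
      rw [← Fin.cons_self_tail v, ← lcone_single, LinearMap.comp_apply, lbd_lcone, map_sub,
        lbd_lcone_zero, sub_self, LinearMap.zero_apply]
    | succ q ih =>
      rw [← Fin.cons_self_tail v, ← lcone_single, LinearMap.comp_apply, lbd_lcone, map_sub,
        lbd_lcone]
      have := ih (Fin.tail v)
      rw [LinearMap.comp_apply] at this
      simp only [this, LinearMap.zero_apply, map_zero, sub_zero, sub_self]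
  exact LinearMap.congr_fun this c

theorem lmap_lbd (f : V → W) (q : ℕ) (c : LC k V (q + 1)) :
    lmap k f q (lbd k V q c) = lbd k W q (lmap k f (q + 1) c) := by
  have : lmap k f q ∘ₗ lbd k V q = lbd k W q ∘ₗ lmap k f (q + 1) := by
    refine Finsupp.lhom_ext fun v r => ?_
    simp only [LinearMap.comp_apply, lbd_single, lmap_single, map_sum, map_smul,
      Function.comp_assoc]
  exact LinearMap.congr_fun this c

theorem lmap_lcone (f : V → W) (p : V) (q : ℕ) (c : LC k V q) :
    lmap k f (q + 1) (lcone k p q c) = lcone k (f p) q (lmap k f q c) := by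
  have : lmap k f (q + 1) ∘ₗ lcone k p q = lcone k (f p) q ∘ₗ lmap k f q := by
    refine Finsupp.lhom_ext fun v r => ?_
    simp only [LinearMap.comp_apply, lcone_single, lmap_single]
    congr 1
    funext i
    refine Fin.cases ?_ (fun i => ?_) i <;> simp
  exact LinearMap.congr_fun this c

variable (b : ∀ q, (Fin (q + 1) → V) → V) (b' : ∀ q, (Fin (q + 1) → W) → W)

/-- Subdivision of ordered chains, with respect to a choice `b` of "barycenters". -/
def sd : ∀ q, LC k V q →ₗ[k] LC k V q
  | 0 => LinearMap.id
  | q + 1 => Finsupp.linearCombination k fun v =>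
      lcone k (b q v) q (sd q (lbd k V q (Finsupp.single v 1)))

/-- The chain homotopy between the identity and the subdivision. -/
def sdT : ∀ q, LC k V q →ₗ[k] LC k V (q + 1)
  | 0 => 0
  | q + 1 => Finsupp.linearCombination k fun v =>
      lcone k (b q v) (q + 1) (Finsupp.single v 1 - sdT q (lbd k V q (Finsupp.single v 1)))

@[simp]
theorem sd_single (q : ℕ) (v : Fin (q + 1) → V) :
    sd k b (q + 1) (Finsupp.single v 1) =
      lcone k (b q v) q (sd k b q (lbd k V q (Finsupp.single v 1))) := by
  simp only [sd, Finsupp.linearCombination_single, one_smul]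

@[simp]
theorem sdT_single (q : ℕ) (v : Fin (q + 1) → V) :
    sdT k b (q + 1) (Finsupp.single v 1) = lcone k (b q v) (q + 1)
      (Finsupp.single v 1 - sdT k b q (lbd k V q (Finsupp.single v 1))) := by
  simp only [sdT, Finsupp.linearCombination_single, one_smul]

theorem lhom_ext_one {M : Type*} [AddCommGroup M] [Module k M] {α : Type*}
    {f g : (α →₀ k) →ₗ[k] M} (h : ∀ a, f (Finsupp.single a 1) = g (Finsupp.single a 1)) :
    f = g := by
  ext a
  exact h a

/-- By the cone formula, the boundary of `b * sd ∂v` is `sd ∂v - b * ∂ sd ∂v`, and by induction the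
last term is `b * sd ∂∂v = 0`. -/
theorem lbd_sd (q : ℕ) (c : LC k V (q + 1)) :
    lbd k V q (sd k b (q + 1) c) = sd k b q (lbd k V q c) := by
  have : lbd k V q ∘ₗ sd k b (q + 1) = sd k b q ∘ₗ lbd k V q := by
    clear c
    refine lhom_ext_one k fun v => ?_
    simp only [LinearMap.comp_apply, sd_single]
    induction q with
    | zero => exact lbd_lcone_zero _ _ _
    | succ q ih =>
      have h : lbd k V q ∘ₗ sd k b (q + 1) = sd k b q ∘ₗ lbd k V q :=
        lhom_ext_one k fun v => by
          simp only [LinearMap.comp_apply, sd_single]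
          exact ih v
      have h' := LinearMap.congr_fun h (lbd k V (q + 1) (Finsupp.single v 1))
      simp only [LinearMap.comp_apply] at h'
      rw [lbd_lcone, h', lbd_lbd, map_zero, map_zero, sub_zero]
  exact LinearMap.congr_fun this c

/-- With `T v = b * (v - T ∂v)`, the cone formula gives `∂T v = v - T ∂v - b * (∂v - ∂T ∂v)`. By
induction and `∂∂ = 0` the last bracket is `sd ∂v`, and its cone is `sd v`. -/
theorem lbd_sdT (q : ℕ) (c : LC k V (q + 1)) :
    lbd k V (q + 1) (sdT k b (q + 1) c) =
      c - sd k b (q + 1) c - sdT k b q (lbd k V q c) := by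
  have key : ∀ q, lbd k V (q + 1) ∘ₗ sdT k b (q + 1) =
      LinearMap.id - sd k b (q + 1) - sdT k b q ∘ₗ lbd k V q := by
    intro q
    induction q with
    | zero =>
      refine lhom_ext_one k fun v => ?_
      simp only [LinearMap.comp_apply, sdT_single, LinearMap.sub_apply, LinearMap.id_apply,
        sd_single, lbd_lcone]
      simp [sdT, sd]
    | succ q ih =>
      refine lhom_ext_one k fun v => ?_
      have h' := LinearMap.congr_fun ih (lbd k V (q + 1) (Finsupp.single v 1))
      simp only [LinearMap.comp_apply, LinearMap.sub_apply, LinearMap.id_apply, lbd_lbd,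
        map_zero, sub_zero] at h'
      simp only [LinearMap.comp_apply, sdT_single, LinearMap.sub_apply, LinearMap.id_apply,
        lbd_lcone]
      rw [map_sub, h', sd_single, sub_sub_cancel]
      abel
  exact LinearMap.congr_fun (key q) c

variable {b b'}

/-- Subdivision is built only from cones, boundaries and `b`, so it commutes with every map that
preserves the chosen barycenters. Affine maps are the intended case. -/
theorem lmap_sd (f : V → W) (hf : ∀ q v, f (b q v) = b' q (f ∘ v)) (q : ℕ) (c : LC k V q) :
    lmap k f q (sd k b q c) = sd k b' q (lmap k f q c) := by
  have : lmap k f q ∘ₗ sd k b q = sd k b' q ∘ₗ lmap k f q := by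
    clear c
    induction q with
    | zero => rfl
    | succ q ih =>
      refine lhom_ext_one k fun v => ?_
      have h' := LinearMap.congr_fun ih (lbd k V q (Finsupp.single v 1))
      simp only [LinearMap.comp_apply] at h'
      rw [LinearMap.comp_apply, sd_single, lmap_lcone, h', hf, lmap_lbd, LinearMap.comp_apply,
        lmap_single, sd_single]
  exact LinearMap.congr_fun this c

theorem lmap_sdT (f : V → W) (hf : ∀ q v, f (b q v) = b' q (f ∘ v)) (q : ℕ) (c : LC k V q) :
    lmap k f (q + 1) (sdT k b q c) = sdT k b' q (lmap k f q c) := by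
  have : lmap k f (q + 1) ∘ₗ sdT k b q = sdT k b' q ∘ₗ lmap k f q := by
    clear c
    induction q with
    | zero => ext; simp [sdT]
    | succ q ih =>
      refine lhom_ext_one k fun v => ?_
      have h' := LinearMap.congr_fun ih (lbd k V q (Finsupp.single v 1))
      simp only [LinearMap.comp_apply] at h'
      rw [LinearMap.comp_apply, sdT_single, lmap_lcone, map_sub, h', hf, lmap_lbd,
        LinearMap.comp_apply, lmap_single, sdT_single]
  exact LinearMap.congr_fun this c

/-- If tuples of `S` give tuples of `S'` by adding the vertex `p`, then the cone operator maps
chains supported in `S` to chains supported in `S'`. -/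
theorem lcone_mem_supported (p : V) {q : ℕ} {S : Set (Fin q → V)} {S' : Set (Fin (q + 1) → V)}
    (h : ∀ w ∈ S, (Fin.cons p w : Fin (q + 1) → V) ∈ S') {c : LC k V q}
    (hc : c ∈ Finsupp.supported k k S) : lcone k p q c ∈ Finsupp.supported k k S' := by
  have := Submodule.mem_map_of_mem (f := lcone k p q) hc
  rw [lcone, Finsupp.lmapDomain_supported] at this
  exact Finsupp.supported_mono (Set.image_subset_iff.2 h) this

/-- Tracks supports through the recursion: the simplices of a subdivision are cones from the
barycenter over the simplices of the subdivided faces. -/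
theorem sd_single_mem_supported {q : ℕ} (v : Fin (q + 1) → V) {S : Set (Fin q → V)}
    {S' : Set (Fin (q + 1) → V)} (h : ∀ w ∈ S, (Fin.cons (b q v) w : Fin (q + 1) → V) ∈ S')
    (hS : ∀ i : Fin (q + 1),
      sd k b q (Finsupp.single (v ∘ i.succAbove) 1) ∈ Finsupp.supported k k S) :
    sd k b (q + 1) (Finsupp.single v 1) ∈ Finsupp.supported k k S' := by
  rw [sd_single, lbd_single, map_sum]
  refine lcone_mem_supported k _ h (Submodule.sum_mem _ fun i _ => ?_)
  rw [map_smul]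
  exact Submodule.smul_mem _ _ (hS i)

/-- A linear map sends chains supported in `S` to `N` if it does so for the elements of `S`. -/
theorem map_mem_of_supported {α M : Type*} [AddCommGroup M] [Module k M] (f : (α →₀ k) →ₗ[k] M)
    (N : Submodule k M) {S : Set α} (h : ∀ a ∈ S, f (Finsupp.single a 1) ∈ N) {c : α →₀ k}
    (hc : c ∈ Finsupp.supported k k S) : f c ∈ N := by
  rw [Finsupp.supported_eq_span_single] at hc
  refine Submodule.span_le (p := N.comap f).2 ?_ hc
  rintro _ ⟨a, ha, rfl⟩
  exact h a ha

end OrderedChains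

/-! ### Affine simplices, barycentric subdivision and small simplices. -/

namespace SingularChains

open OrderedChains

/-- The affine map of simplices with given vertices. -/
def aff {q m : ℕ} (w : Fin (q + 1) → Splx m) : C(Splx q, Splx m) where
  toFun x := ⟨∑ j, x j • (w j).1, (convex_stdSimplex ℝ _).sum_mem (fun j _ => x.2.1 j)
    x.2.2 fun j _ => (w j).2⟩
  continuous_toFun := by
    refine Continuous.subtype_mk (continuous_finsetSum _ fun j _ => ?_) _
    exact ((continuous_apply j).comp continuous_subtype_val).smul continuous_const

theorem aff_val {q m : ℕ} (w : Fin (q + 1) → Splx m) (x : Splx q) :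
    (aff w x).1 = ∑ j, x j • (w j).1 := rfl

theorem aff_apply {q m : ℕ} (w : Fin (q + 1) → Splx m) (x : Splx q) (i : Fin (m + 1)) :
    aff w x i = ∑ j, x j * w j i := by
  change (aff w x).1 i = _
  rw [aff_val, Finset.sum_apply]
  rfl

theorem aff_aff {q m l : ℕ} (w : Fin (m + 1) → Splx l) (v : Fin (q + 1) → Splx m) (x : Splx q) :
    aff w (aff v x) = aff (aff w ∘ v) x := by
  ext i
  simp only [aff_apply, Function.comp_apply, Finset.sum_mul, Finset.mul_sum, mul_assoc]
  exact Finset.sum_comm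

theorem aff_vertex {q m : ℕ} (w : Fin (q + 1) → Splx m) (i : Fin (q + 1)) :
    aff w (stdSimplex.vertex i) = w i := by
  ext j
  simp [aff_apply, Pi.single_apply]

theorem aff_vertices (q : ℕ) : aff (q := q) stdSimplex.vertex = ContinuousMap.id _ := by
  ext x j
  simp [aff_apply, Pi.single_apply]

theorem aff_comp_face {q m : ℕ} (w : Fin (q + 2) → Splx m) (i : Fin (q + 2)) :
    (aff w).comp (face i) = aff (w ∘ i.succAbove) := by
  have : face (n := q) i = aff (fun j => stdSimplex.vertex (i.succAbove j)) := by
    ext x j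
    simp only [face, ContinuousMap.coe_mk, stdSimplex.map_coe, FunOnFinite.linearMap_apply_apply,
      aff_apply, stdSimplex.vertex_coe, Pi.single_apply, mul_ite, mul_one, mul_zero,
      Finset.sum_ite, Finset.sum_const_zero, add_zero]
    exact Finset.sum_congr (by ext; simp [eq_comm]) fun _ _ => rfl
  ext x : 1
  rw [ContinuousMap.comp_apply, this, aff_aff]
  congr 2
  funext j
  exact aff_vertex _ _

/-- The barycenter of an affine simplex. -/
def bary (m q : ℕ) (w : Fin (q + 1) → Splx m) : Splx m := aff w stdSimplex.barycenter

theorem aff_bary {m l : ℕ} (w : Fin (m + 1) → Splx l) (q : ℕ) (v : Fin (q + 1) → Splx m) :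
    aff w (bary m q v) = bary l q (aff w ∘ v) :=
  aff_aff _ _ _

theorem dist_aff_le {q m : ℕ} (w : Fin (q + 1) → Splx m) (x : Splx q) (p : Splx m) {R : ℝ}
    (h : ∀ j, dist p (w j) ≤ R) : dist p (aff w x) ≤ R := by
  rw [Subtype.dist_eq, dist_comm, ← Metric.mem_closedBall]
  refine (convex_closedBall p.1 R).sum_mem (fun j _ => x.2.1 j) x.2.2 fun j _ => ?_
  rw [Metric.mem_closedBall, dist_comm]
  exact h j

/-- The difference is the average of `q + 1` vectors `w l - w j`, one of which vanishes; hence the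
factor `q / (q + 1)`. -/
theorem dist_bary_le {q m : ℕ} (w : Fin (q + 1) → Splx m) {r : ℝ}
    (h : ∀ i j, dist (w i) (w j) ≤ r) (j : Fin (q + 1)) :
    dist (bary m q w) (w j) ≤ (1 - 1 / ((q + 1 : ℕ) : ℝ)) * r := by
  have hq : ((q + 1 : ℕ) : ℝ) ≠ 0 := by positivity
  have h1 : (bary m q w).1 - (w j).1 =
      ∑ l, ((q + 1 : ℕ) : ℝ)⁻¹ • ((w l).1 - (w j).1) := by
    rw [← Finset.smul_sum, Finset.sum_sub_distrib, smul_sub, bary, aff_val, Finset.smul_sum]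
    simp only [Finset.sum_const, Finset.card_univ, Fintype.card_fin, ← Nat.cast_smul_eq_nsmul ℝ,
      inv_smul_smul₀ hq]
    congr 1
    refine Finset.sum_congr rfl fun l _ => ?_
    congr 1
    change ((Fintype.card (Fin (q + 1)) : ℕ) : ℝ)⁻¹ = _
    rw [Fintype.card_fin]
  rw [Subtype.dist_eq, dist_eq_norm, h1]
  calc ‖∑ l, ((q + 1 : ℕ) : ℝ)⁻¹ • ((w l).1 - (w j).1)‖
      ≤ ∑ l, ‖((q + 1 : ℕ) : ℝ)⁻¹ • ((w l).1 - (w j).1)‖ := norm_sum_le _ _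
    _ ≤ ∑ l, if l = j then 0 else ((q + 1 : ℕ) : ℝ)⁻¹ * r := by
        refine Finset.sum_le_sum fun l _ => ?_
        split_ifs with hl
        · simp [hl]
        · rw [norm_smul, Real.norm_of_nonneg (by positivity), ← dist_eq_norm]
          exact mul_le_mul_of_nonneg_left (h l j) (by positivity)
    _ = (1 - 1 / ((q + 1 : ℕ) : ℝ)) * r := by
        rw [Finset.sum_ite, Finset.sum_const_zero, zero_add, Finset.sum_const,
          Finset.filter_ne', Finset.card_erase_of_mem (Finset.mem_univ _), Finset.card_univ,
          Fintype.card_fin, nsmul_eq_mul]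
        push_cast
        field_simp
        ring

variable (k : Type) [Field k]

/-- Closed balls are convex, so subdividing never leaves a ball that contains the vertices. -/
theorem sd_single_dist_le (m : ℕ) (p : Splx m) {R : ℝ} (q : ℕ) (v : Fin q → Splx m)
    (h : ∀ j, dist p (v j) ≤ R) : sd k (bary m) q (Finsupp.single v 1) ∈
      Finsupp.supported k k {w | ∀ j, dist p (w j) ≤ R} := by
  induction q with
  | zero => exact Finsupp.single_mem_supported k _ h
  | succ q ih =>
    refine sd_single_mem_supported k v (S := {w | ∀ j, dist p (w j) ≤ R}) (fun w hw => ?_)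
      fun i => ih _ fun j => h _
    refine Fin.cases ?_ fun j => ?_
    · exact dist_aff_le v _ p h
    · exact hw j

/-- Subdivision shrinks the diameter of affine simplices. -/
theorem sd_single_mesh_le (m q : ℕ) (v : Fin q → Splx m) {r : ℝ}
    (h : ∀ i j, dist (v i) (v j) ≤ r) : sd k (bary m) q (Finsupp.single v 1) ∈
      Finsupp.supported k k {w | ∀ i j, dist (w i) (w j) ≤ (1 - 1 / (q : ℝ)) * r} := by
  induction q with
  | zero => exact Finsupp.single_mem_supported k _ fun i => i.elim0
  | succ q ih =>
    have hr : 0 ≤ r := dist_nonneg.trans (h 0 0)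
    -- An edge either lies in a subdivided face, where induction applies, or joins the barycenter to
    -- a point of such a face, which stays in a ball around the barycenter.
    refine sd_single_mem_supported k v
      (S := {w | ∀ i j, dist (w i) (w j) ≤ (1 - 1 / (q : ℝ)) * r} ∩
        {w | ∀ j, dist (bary m q v) (w j) ≤ (1 - 1 / ((q + 1 : ℕ) : ℝ)) * r}) ?_ fun i => ?_
    · rintro w ⟨hw, hw'⟩
      have h0 : 0 ≤ (1 - 1 / ((q + 1 : ℕ) : ℝ)) * r := by
        refine mul_nonneg (sub_nonneg.2 ?_) hr
        rw [div_le_one (by positivity)]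
        exact_mod_cast Nat.succ_le_succ (Nat.zero_le q)
      refine Fin.cases (Fin.cases ?_ fun j => ?_) fun i => Fin.cases ?_ fun j => ?_
      · simpa using h0
      · exact hw' j
      · rw [dist_comm]
        exact hw' i
      · refine (hw i j).trans (mul_le_mul_of_nonneg_right (sub_le_sub_left ?_ _) hr)
        have : 0 < (q : ℝ) := by exact_mod_cast i.pos
        exact one_div_le_one_div_of_le this (by push_cast; linarith)
    · rw [Finsupp.supported_inter]
      exact ⟨ih _ fun _ _ => h _ _, sd_single_dist_le k m _ q _ fun j => dist_bary_le v h _⟩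

variable {X : Type} [TopologicalSpace X]

/-- The singular chain given by a chain of affine simplices in a singular simplex. -/
def carry {m : ℕ} (σ : C(Splx m, X)) (q : ℕ) : LC k (Splx m) (q + 1) →ₗ[k] Ch k X q :=
  Finsupp.lmapDomain k k fun w => σ.comp (aff w)

@[simp]
theorem carry_single {m : ℕ} (σ : C(Splx m, X)) (q : ℕ) (w : Fin (q + 1) → Splx m) (r : k) :
    carry k σ q (Finsupp.single w r) = Finsupp.single (σ.comp (aff w)) r := by
  simp [carry]

theorem carry_vertices {m : ℕ} (σ : C(Splx m, X)) (r : k) :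
    carry k σ m (Finsupp.single stdSimplex.vertex r) = Finsupp.single σ r := by
  rw [carry_single, aff_vertices, ContinuousMap.comp_id]

theorem bdry_carry {m : ℕ} (σ : C(Splx m, X)) (q : ℕ) (c : LC k (Splx m) (q + 2)) :
    bdry k X q (carry k σ (q + 1) c) = carry k σ q (lbd k _ (q + 1) c) := by
  have : bdry k X q ∘ₗ carry k σ (q + 1) = carry k σ q ∘ₗ lbd k _ (q + 1) := by
    refine Finsupp.lhom_ext fun v r => ?_
    simp only [LinearMap.comp_apply, lbd_single, carry_single, bdry_single, map_sum, map_smul,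
      ContinuousMap.comp_assoc, aff_comp_face]
  exact LinearMap.congr_fun this c

theorem carry_lmap {m l : ℕ} (σ : C(Splx m, X)) (w : Fin (l + 1) → Splx m) (q : ℕ)
    (c : LC k (Splx l) (q + 1)) :
    carry k (σ.comp (aff w)) q c = carry k σ q (lmap k (aff w) (q + 1) c) := by
  have : carry k (σ.comp (aff w)) q = carry k σ q ∘ₗ lmap k (aff w) (q + 1) := by
    refine Finsupp.lhom_ext fun v r => ?_
    simp only [carry_single, LinearMap.comp_apply, lmap_single]
    congr 1
    ext x
    simp [aff_aff]
  exact LinearMap.congr_fun this c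

/-- Barycentric subdivision of singular chains. -/
def Sd (X : Type) [TopologicalSpace X] (n : ℕ) : Ch k X n →ₗ[k] Ch k X n :=
  Finsupp.linearCombination k fun σ =>
    carry k σ n (sd k (bary n) (n + 1) (Finsupp.single stdSimplex.vertex 1))

/-- The chain homotopy between the identity and barycentric subdivision. -/
def SdT (X : Type) [TopologicalSpace X] (n : ℕ) : Ch k X n →ₗ[k] Ch k X (n + 1) :=
  Finsupp.linearCombination k fun σ =>
    carry k σ (n + 1) (sdT k (bary n) (n + 1) (Finsupp.single stdSimplex.vertex 1))

theorem aff_comp_vertex {q m : ℕ} (w : Fin (q + 1) → Splx m) :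
    aff w ∘ stdSimplex.vertex = w :=
  funext fun i => aff_vertex w i

/-- Naturality under affine maps allows subdividing inside the model simplex. With `SdT_carry`, it
transfers the identities of ordered chains to singular chains, each simplex being carried by its own
model (`carry_vertices`). -/
theorem Sd_carry {m : ℕ} (σ : C(Splx m, X)) (q : ℕ) (c : LC k (Splx m) (q + 1)) :
    Sd k X q (carry k σ q c) = carry k σ q (sd k (bary m) (q + 1) c) := by
  have : Sd k X q ∘ₗ carry k σ q = carry k σ q ∘ₗ sd k (bary m) (q + 1) := by
    refine lhom_ext_one k fun w => ?_
    rw [LinearMap.comp_apply, carry_single, Sd, Finsupp.linearCombination_single, one_smul,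
      carry_lmap, lmap_sd k (b' := bary m) _ (aff_bary w), lmap_single, aff_comp_vertex]
    rfl
  exact LinearMap.congr_fun this c

theorem SdT_carry {m : ℕ} (σ : C(Splx m, X)) (q : ℕ) (c : LC k (Splx m) (q + 1)) :
    SdT k X q (carry k σ q c) = carry k σ (q + 1) (sdT k (bary m) (q + 1) c) := by
  have : SdT k X q ∘ₗ carry k σ q = carry k σ (q + 1) ∘ₗ sdT k (bary m) (q + 1) := by
    refine lhom_ext_one k fun w => ?_
    rw [LinearMap.comp_apply, carry_single, SdT, Finsupp.linearCombination_single, one_smul,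
      carry_lmap, lmap_sdT k (b' := bary m) _ (aff_bary w), lmap_single, aff_comp_vertex]
    rfl
  exact LinearMap.congr_fun this c

theorem bdry_Sd (n : ℕ) (c : Ch k X (n + 1)) :
    bdry k X n (Sd k X (n + 1) c) = Sd k X n (bdry k X n c) := by
  have : bdry k X n ∘ₗ Sd k X (n + 1) = Sd k X n ∘ₗ bdry k X n := by
    refine lhom_ext_one k fun σ => ?_
    rw [← carry_vertices, LinearMap.comp_apply, LinearMap.comp_apply, Sd_carry, bdry_carry,
      bdry_carry, Sd_carry, lbd_sd]
  exact LinearMap.congr_fun this c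

theorem bdry_SdT (n : ℕ) (c : Ch k X (n + 1)) :
    bdry k X (n + 1) (SdT k X (n + 1) c) = c - Sd k X (n + 1) c - SdT k X n (bdry k X n c) := by
  have : bdry k X (n + 1) ∘ₗ SdT k X (n + 1) =
      LinearMap.id - Sd k X (n + 1) - SdT k X n ∘ₗ bdry k X n := by
    refine lhom_ext_one k fun σ => ?_
    rw [← carry_vertices]
    simp only [LinearMap.comp_apply, LinearMap.sub_apply, LinearMap.id_apply]
    rw [SdT_carry, bdry_carry, bdry_carry, SdT_carry, Sd_carry, lbd_sdT, map_sub, map_sub]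
  exact LinearMap.congr_fun this c

theorem bdry_bdry (n : ℕ) (c : Ch k X (n + 2)) : bdry k X n (bdry k X (n + 1) c) = 0 := by
  have : bdry k X n ∘ₗ bdry k X (n + 1) = 0 := by
    refine lhom_ext_one k fun σ => ?_
    rw [← carry_vertices, LinearMap.comp_apply, bdry_carry, bdry_carry, lbd_lbd, map_zero]
    rfl
  exact LinearMap.congr_fun this c

/-- The chains that are small with respect to a family of subsets. -/
def small {ι : Type*} (U : ι → Set X) (n : ℕ) : Submodule k (Ch k X n) :=
  Finsupp.supported k k {σ | ∃ i, Set.range σ ⊆ U i}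

variable {ι : Type*} (U : ι → Set X)

theorem carry_mem_small {m : ℕ} (σ : C(Splx m, X)) {i : ι} (h : Set.range σ ⊆ U i) (q : ℕ)
    (c : LC k (Splx m) (q + 1)) : carry k σ q c ∈ small k U q := by
  refine map_mem_of_supported k (S := Set.univ) _ _ (fun w _ => ?_) (by simp)
  rw [carry_single]
  refine Finsupp.single_mem_supported k _ ⟨i, ?_⟩
  rintro _ ⟨x, rfl⟩
  exact h ⟨_, rfl⟩

theorem Sd_mem_small {n : ℕ} {c : Ch k X n} (hc : c ∈ small k U n) : Sd k X n c ∈ small k U n := by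
  refine map_mem_of_supported k _ _ ?_ hc
  rintro σ ⟨i, h⟩
  rw [← carry_vertices, Sd_carry]
  exact carry_mem_small k U σ h n _

theorem SdT_mem_small {n : ℕ} {c : Ch k X n} (hc : c ∈ small k U n) :
    SdT k X n c ∈ small k U (n + 1) := by
  refine map_mem_of_supported k _ _ ?_ hc
  rintro σ ⟨i, h⟩
  rw [← carry_vertices, SdT_carry]
  exact carry_mem_small k U σ h _ _

theorem iterate_sd_mem (m : ℕ) (j : ℕ) :
    ((sd k (bary m) (m + 1)) ^ j) (Finsupp.single stdSimplex.vertex 1) ∈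
      Finsupp.supported k k
        {w | ∀ a b, dist (w a) (w b) ≤ (1 - 1 / ((m + 1 : ℕ) : ℝ)) ^ j} := by
  induction j with
  | zero =>
    refine Finsupp.single_mem_supported k _ fun a b => ?_
    -- The standard simplex has diameter at most 1 in the sup norm, which starts the geometric
    -- decay.
    rw [pow_zero, Subtype.dist_eq]
    exact (Metric.dist_le_diam_of_mem (bounded_stdSimplex _) (Subtype.property _)
      (Subtype.property _)).trans diam_stdSimplex_le
  | succ j ih =>
    rw [pow_succ' (sd k (bary m) (m + 1)), Module.End.mul_apply]
    refine map_mem_of_supported k _ _ (fun w hw => ?_) ih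
    simp only [pow_succ']
    exact sd_single_mesh_le k m (m + 1) w hw

/-- Iterated subdivision makes every singular chain small. -/
theorem exists_iterate_Sd_mem_small (hU : ∀ i, IsOpen (U i)) (hcov : ∀ x, ∃ i, x ∈ U i) (n : ℕ)
    (c : Ch k X n) : ∃ j, ((Sd k X n) ^ j) c ∈ small k U n := by
  induction c using Finsupp.induction_linear with
  | zero => exact ⟨0, by simp⟩
  | add f g hf hg =>
    obtain ⟨a, ha⟩ := hf
    obtain ⟨b, hb⟩ := hg
    have key (i : ℕ) {c : Ch k X n} (hc : c ∈ small k U n) : ((Sd k X n) ^ i) c ∈ small k U n := by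
      induction i with
      | zero => exact hc
      | succ i ih =>
        rw [pow_succ', Module.End.mul_apply]
        exact Sd_mem_small k U ih
    refine ⟨a + b, ?_⟩
    rw [map_add]
    refine Submodule.add_mem _ ?_ ?_
    · rw [add_comm a b, pow_add, Module.End.mul_apply]
      exact key _ ha
    · rw [pow_add, Module.End.mul_apply]
      exact key _ hb
  | single σ r =>
    -- With `δ` a Lebesgue number of the pulled-back cover, it suffices to subdivide until the mesh
    -- is below `δ`: each small simplex then lies in the `δ`-ball around its vertex `w 0`.
    obtain ⟨δ, hδ, hball⟩ := lebesgue_number_lemma_of_metric (isCompact_univ (X := Splx n))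
      (fun i => (hU i).preimage σ.continuous) (fun x _ => Set.mem_iUnion.2 (hcov (σ x)))
    have h0 : 0 ≤ 1 - 1 / ((n + 1 : ℕ) : ℝ) := by
      rw [sub_nonneg, div_le_one (by positivity)]
      exact_mod_cast Nat.succ_le_succ (Nat.zero_le n)
    have h1 : 1 - 1 / ((n + 1 : ℕ) : ℝ) < 1 := by
      have : 0 < 1 / ((n + 1 : ℕ) : ℝ) := by positivity
      linarith
    obtain ⟨j, hj⟩ := exists_pow_lt_of_lt_one hδ h1
    refine ⟨j, ?_⟩
    have hcomm : ∀ (j : ℕ) (c : LC k (Splx n) (n + 1)), ((Sd k X n) ^ j) (carry k σ n c) =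
        carry k σ n (((sd k (bary n) (n + 1)) ^ j) c) := by
      intro j
      induction j with
      | zero => intro c; rfl
      | succ j ih =>
        intro c
        rw [pow_succ, Module.End.mul_apply, Sd_carry, ih, pow_succ, Module.End.mul_apply]
    rw [← mul_one r, ← smul_eq_mul, ← Finsupp.smul_single, map_smul, ← carry_vertices, hcomm]
    refine Submodule.smul_mem _ _ (map_mem_of_supported k _ _ (fun w hw => ?_)
      (iterate_sd_mem k n j))
    rw [carry_single]
    obtain ⟨i, hi⟩ := hball (w 0) trivial
    refine Finsupp.single_mem_supported k _ ⟨i, ?_⟩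
    rintro _ ⟨x, rfl⟩
    apply hi
    rw [Metric.mem_ball, dist_comm]
    exact (dist_aff_le w x (w 0) fun b => hw 0 b).trans_lt hj

/-- The small simplices theorem: a relative cycle is homologous to a small chain. -/
theorem exists_sub_bdry_mem_small (hU : ∀ i, IsOpen (U i)) (hcov : ∀ x, ∃ i, x ∈ U i) (n : ℕ)
    (z : Ch k X (n + 1)) (hz : bdry k X n z ∈ small k U n) :
    ∃ w, z - bdry k X (n + 1) w ∈ small k U (n + 1) := by
  obtain ⟨j, hj⟩ := exists_iterate_Sd_mem_small k U hU hcov (n + 1) z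
  induction j generalizing z with
  | zero => exact ⟨0, by simpa using hj⟩
  | succ j ih =>
    -- Induction applies to `Sd z`. The homotopy exchanges `z` for `Sd z` up to a boundary and the
    -- term `SdT ∂z`, which is small because `∂z` is.
    rw [pow_succ, Module.End.mul_apply] at hj
    obtain ⟨w, hw⟩ := ih (Sd k X (n + 1) z) (by rw [bdry_Sd]; exact Sd_mem_small k U hz) hj
    refine ⟨w + SdT k X (n + 1) z, ?_⟩
    have h := bdry_SdT k n z
    have : z - bdry k X (n + 1) (w + SdT k X (n + 1) z) =
        (Sd k X (n + 1) z - bdry k X (n + 1) w) + SdT k X n (bdry k X n z) := by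
      rw [map_add, h]
      abel
    rw [this]
    exact Submodule.add_mem _ hw (SdT_mem_small k U hz)

end SingularChains

/-- `H` is the quotient of `Z` by the kernel of `p`, which equals the kernel of `q ∘ s`. Used to
turn a construction on cycles into an isomorphism on homology. -/
theorem LinearMap.exists_equiv_of_surjective {R Z H Z' H' : Type*} [Ring R] [AddCommMonoid Z]
    [AddCommGroup H] [AddCommMonoid Z'] [AddCommGroup H'] [Module R Z] [Module R H] [Module R Z']
    [Module R H'] (p : Z →ₗ[R] H) (q : Z' →ₗ[R] H') (s : Z →ₗ[R] Z') (hp : Function.Surjective p)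
    (hker : ∀ z, q (s z) = 0 ↔ p z = 0) (hs : ∀ y, ∃ z, q (s z) = y) :
    ∃ e : H ≃ₗ[R] H', ∀ z, e (p z) = q (s z) := by
  have h1 (z z' : Z) (h : p z = p z') : q (s z) = q (s z') := by
    -- `Z` is only assumed to be a monoid, so the difference is written with the scalar `-1`.
    have := (hker (z + (-1 : R) • z')).2 (by simp [h])
    simpa [add_neg_eq_zero] using this
  let f : H →ₗ[R] H' :=
    { toFun h := q (s (Function.surjInv hp h))
      map_add' x y := by
        rw [← map_add, ← map_add]
        exact h1 _ _ (by simp [Function.surjInv_eq])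
      map_smul' r x := by
        rw [RingHom.id_apply, ← map_smul, ← map_smul]
        exact h1 _ _ (by simp [Function.surjInv_eq]) }
  have hf (z : Z) : f (p z) = q (s z) := h1 _ _ (Function.surjInv_eq hp _)
  refine ⟨LinearEquiv.ofBijective f ⟨?_, fun y => ?_⟩, hf⟩
  · rw [injective_iff_map_eq_zero]
    intro h hh
    obtain ⟨z, rfl⟩ := hp h
    rwa [hf, hker] at hh
  · obtain ⟨z, hz⟩ := hs y
    exact ⟨p z, (hf z).trans hz⟩

theorem ContinuousMap.range_comp_subset {X Y Z : Type*} [TopologicalSpace X] [TopologicalSpace Y]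
    [TopologicalSpace Z] (f : C(Y, Z)) (g : C(X, Y)) : Set.range (f.comp g) ⊆ Set.range f := by
  rintro _ ⟨x, rfl⟩
  exact ⟨g x, rfl⟩

/-! ### Cones over singular simplices with a non-Hausdorff apex. -/

namespace SingularChains

open OrderedChains

theorem face_self {n : ℕ} (i : Fin (n + 2)) (x : Splx n) : face i x i = 0 := by
  simp only [face, ContinuousMap.coe_mk, stdSimplex.map_coe, FunOnFinite.linearMap_apply_apply]
  refine Finset.sum_eq_zero fun j hj => ?_
  simp [Fin.succAbove_ne] at hj

theorem face_succAbove {n : ℕ} (i : Fin (n + 2)) (x : Splx n) (j : Fin (n + 1)) :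
    face i x (i.succAbove j) = x j := by
  simp only [face, ContinuousMap.coe_mk, stdSimplex.map_coe, FunOnFinite.linearMap_apply_apply,
    Fin.succAbove_right_inj]
  rw [Finset.filter_eq' _ j]
  simp

theorem face_succ_zero {n : ℕ} (i : Fin (n + 2)) (x : Splx (n + 1)) :
    face i.succ x 0 = x 0 := by
  have := face_succAbove i.succ x 0
  rwa [Fin.succ_succAbove_zero] at this

/-- The projection of the standard simplex to the face opposite to the zeroth vertex. -/
def dropZero {n : ℕ} (x : Splx (n + 1)) (hx : x 0 ≠ 1) : Splx n :=
  ⟨fun i => x i.succ / (1 - x 0), fun i => div_nonneg (x.2.1 _) (sub_nonneg.2 (by simp)), by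
    have h : ∑ i, x i = 1 := x.2.2
    rw [Fin.sum_univ_succ] at h
    rw [← Finset.sum_div, div_eq_one_iff_eq (sub_ne_zero.2 hx.symm)]
    linarith⟩

theorem dropZero_apply {n : ℕ} (x : Splx (n + 1)) (hx : x 0 ≠ 1) (i : Fin (n + 1)) :
    dropZero x hx i = x i.succ / (1 - x 0) := rfl

theorem continuous_coord {n : ℕ} (i : Fin (n + 1)) : Continuous fun x : Splx n => x i :=
  (continuous_apply i).comp continuous_subtype_val

theorem continuous_dropZero {n : ℕ} :
    Continuous fun x : {x : Splx (n + 1) // x 0 ≠ 1} => dropZero x.1 x.2 := by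
  refine Continuous.subtype_mk (continuous_pi fun i => ?_) _
  exact ((continuous_coord _).comp continuous_subtype_val).div₀
    (continuous_const.sub ((continuous_coord _).comp continuous_subtype_val))
    fun x => sub_ne_zero.2 x.2.symm

section Cone

variable {X Y : Type} [TopologicalSpace X] [TopologicalSpace Y]

open Classical in
/-- The cone of a singular simplex, with apex a point all of whose neighbourhoods contain
the simplex. -/
def coneMap {n : ℕ} (σ : C(Splx n, Y)) (p : Y)
    (hp : ∀ U, IsOpen U → p ∈ U → Set.range σ ⊆ U) : C(Splx (n + 1), Y) where
  toFun x := if h : x 0 = 1 then p else σ (dropZero x h)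
  continuous_toFun := by
    -- An open set containing the apex contains the whole cone. Any other open set has its preimage
    -- inside the open region `x 0 ≠ 1`, where the projection to the base is continuous.
    refine continuous_def.2 fun U hU => ?_
    by_cases hpU : p ∈ U
    · convert isOpen_univ
      refine Set.eq_univ_of_forall fun x => ?_
      rw [Set.mem_preimage]
      split_ifs
      · exact hpU
      · exact hp U hU hpU ⟨_, rfl⟩
    · have ho : IsOpen {x : Splx (n + 1) | x 0 ≠ 1} :=
        isOpen_ne_fun (continuous_coord 0) continuous_const
      have h1 := ho.isOpenMap_subtype_val _ (hU.preimage (σ.continuous.comp continuous_dropZero))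
      convert h1
      ext x
      rw [Set.mem_preimage]
      constructor
      · intro h
        split_ifs at h with hx
        · exact (hpU h).elim
        · exact ⟨⟨x, hx⟩, h, rfl⟩
      · rintro ⟨⟨x, hx⟩, h, rfl⟩
        rw [dif_neg hx]
        exact h

theorem coneMap_of_eq {n : ℕ} (σ : C(Splx n, Y)) (p : Y)
    (hp : ∀ U, IsOpen U → p ∈ U → Set.range σ ⊆ U) (x : Splx (n + 1)) (h : x 0 = 1) :
    coneMap σ p hp x = p := dif_pos h

theorem coneMap_of_ne {n : ℕ} (σ : C(Splx n, Y)) (p : Y)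
    (hp : ∀ U, IsOpen U → p ∈ U → Set.range σ ⊆ U) (x : Splx (n + 1)) (h : x 0 ≠ 1) :
    coneMap σ p hp x = σ (dropZero x h) := dif_neg h

theorem coneMap_face_zero {n : ℕ} (σ : C(Splx n, Y)) (p : Y)
    (hp : ∀ U, IsOpen U → p ∈ U → Set.range σ ⊆ U) : (coneMap σ p hp).comp (face 0) = σ := by
  ext x
  have h0 : face 0 x 0 = 0 := face_self 0 x
  have h : face 0 x 0 ≠ 1 := by rw [h0]; exact zero_ne_one
  rw [ContinuousMap.comp_apply, coneMap_of_ne _ _ _ _ h]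
  congr 1
  ext i
  have := face_succAbove 0 x i
  rw [Fin.succAbove_zero] at this
  rw [dropZero_apply, h0, this, sub_zero, div_one]

theorem dropZero_face_succ {n : ℕ} (i : Fin (n + 2)) (x : Splx (n + 1)) (hx : x 0 ≠ 1)
    (hx' : face i.succ x 0 ≠ 1) : dropZero (face i.succ x) hx' = face i (dropZero x hx) := by
  ext j
  rw [dropZero_apply, face_succ_zero]
  rcases Fin.eq_self_or_eq_succAbove i j with rfl | ⟨l, rfl⟩
  · rw [face_self, face_self, zero_div]
  · rw [face_succAbove, ← Fin.succ_succAbove_succ, face_succAbove, dropZero_apply]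

theorem coneMap_face_succ {n : ℕ} (σ : C(Splx (n + 1), Y)) (p : Y)
    (hp : ∀ U, IsOpen U → p ∈ U → Set.range σ ⊆ U) (i : Fin (n + 2)) :
    (coneMap σ p hp).comp (face i.succ) = coneMap (σ.comp (face i)) p
      (fun U hU hpU => (ContinuousMap.range_comp_subset _ _).trans (hp U hU hpU)) := by
  ext x
  rw [ContinuousMap.comp_apply]
  by_cases h : x 0 = 1
  · rw [coneMap_of_eq _ _ _ _ h, coneMap_of_eq]
    rw [face_succ_zero, h]
  · have h' : face i.succ x 0 ≠ 1 := by rwa [face_succ_zero]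
    rw [coneMap_of_ne _ _ _ _ h, coneMap_of_ne _ _ _ _ h', dropZero_face_succ i x h h']
    rfl

variable (k : Type) [Field k] (p : Y) (V : Set Y)

open Classical in
/-- The cone operator on singular chains in `V`, where all neighbourhoods of `p` contain `V`. -/
def coneOp (hp : ∀ U, IsOpen U → p ∈ U → V ⊆ U) (n : ℕ) : Ch k Y n →ₗ[k] Ch k Y (n + 1) :=
  Finsupp.linearCombination k fun σ =>
    if h : Set.range σ ⊆ V then
      Finsupp.single (coneMap σ p fun U hU hpU => h.trans (hp U hU hpU)) 1
    else 0

/-- The chains with support in `V`. -/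
def chainsIn (n : ℕ) : Submodule k (Ch k Y n) :=
  Finsupp.supported k k {σ | Set.range σ ⊆ V}

variable {p V} (hp : ∀ U, IsOpen U → p ∈ U → V ⊆ U)

theorem coneOp_single {n : ℕ} (σ : C(Splx n, Y)) (h : Set.range σ ⊆ V) :
    coneOp k p V hp n (Finsupp.single σ 1) =
      Finsupp.single (coneMap σ p fun U hU hpU => h.trans (hp U hU hpU)) 1 := by
  rw [coneOp, Finsupp.linearCombination_single, one_smul, dif_pos h]

theorem bdry_mem_chainsIn {n : ℕ} {c : Ch k Y (n + 1)} (hc : c ∈ chainsIn k V (n + 1)) :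
    bdry k Y n c ∈ chainsIn k V n := by
  refine map_mem_of_supported k _ _ (fun σ hσ => ?_) hc
  rw [bdry_single]
  refine Submodule.sum_mem _ fun i _ => Submodule.smul_mem _ _ ?_
  exact Finsupp.single_mem_supported k _ ((ContinuousMap.range_comp_subset _ _).trans hσ)

theorem coneOp_mem_chainsIn (hpV : p ∈ V) {n : ℕ} {c : Ch k Y n} (hc : c ∈ chainsIn k V n) :
    coneOp k p V hp n c ∈ chainsIn k V (n + 1) := by
  refine map_mem_of_supported k _ _ (fun σ hσ => ?_) hc
  rw [coneOp_single k hp σ hσ]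
  refine Finsupp.single_mem_supported k _ ?_
  rintro _ ⟨x, rfl⟩
  by_cases h : x 0 = 1
  · rwa [coneMap_of_eq _ _ _ _ h]
  · rw [coneMap_of_ne _ _ _ _ h]
    exact hσ ⟨_, rfl⟩

/-- The zeroth face of a cone is its base and the other faces are cones on the faces of the base, so
the formula of ordered chains reappears. -/
theorem bdry_coneOp {n : ℕ} {c : Ch k Y (n + 1)} (hc : c ∈ chainsIn k V (n + 1)) :
    bdry k Y (n + 1) (coneOp k p V hp (n + 1) c) = c - coneOp k p V hp n (bdry k Y n c) := by
  have := map_mem_of_supported k (bdry k Y (n + 1) ∘ₗ coneOp k p V hp (n + 1) -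
    (LinearMap.id - coneOp k p V hp n ∘ₗ bdry k Y n)) ⊥ (fun σ hσ => ?_) hc
  · rw [Submodule.mem_bot, LinearMap.sub_apply, sub_eq_zero] at this
    exact this
  · have hf (i) : Set.range (σ.comp (face i)) ⊆ V := (ContinuousMap.range_comp_subset _ _).trans hσ
    rw [Submodule.mem_bot, LinearMap.sub_apply, sub_eq_zero]
    simp only [LinearMap.comp_apply, coneOp_single k hp σ hσ, bdry_single, LinearMap.sub_apply,
      LinearMap.id_apply, map_sum, map_smul, coneOp_single k hp _ (hf _)]
    rw [Fin.sum_univ_succ]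
    simp only [coneMap_face_zero, coneMap_face_succ, Fin.val_zero, pow_zero, one_smul,
      Fin.val_succ, pow_succ, mul_neg, mul_one, neg_smul, Finset.sum_neg_distrib, sub_eq_add_neg]

end Cone

section Embedding

variable {X Y : Type} [TopologicalSpace X] [TopologicalSpace Y] (k : Type) [Field k]

theorem push_injective {f : C(X, Y)} (hf : Function.Injective f) (n : ℕ) :
    Function.Injective (push k f n) := by
  refine Finsupp.mapDomain_injective fun σ τ h => ?_
  ext x
  exact hf (DFunLike.congr_fun h x)

theorem push_mem_chainsIn (f : C(X, Y)) {V : Set Y} (hV : Set.range f ⊆ V) (n : ℕ)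
    (c : Ch k X n) : push k f n c ∈ chainsIn k V n := by
  refine map_mem_of_supported k (S := Set.univ) _ _ (fun σ _ => ?_) (by simp)
  rw [push_single]
  exact Finsupp.single_mem_supported k _ ((ContinuousMap.range_comp_subset _ _).trans hV)

/-- Simplices in the image lift pointwise, and the lift is continuous because the topology is
induced. -/
theorem exists_push_eq {f : C(X, Y)} (hf : Topology.IsInducing f) {n : ℕ} {c : Ch k Y n}
    (hc : c ∈ chainsIn k (Set.range f) n) : ∃ c', push k f n c' = c := by
  rw [← LinearMap.mem_range]
  refine map_mem_of_supported k LinearMap.id _ (fun σ hσ => ?_) hc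
  have h (x) : ∃ y, f y = σ x := hσ ⟨x, rfl⟩
  choose g hg using h
  have hg' : f ∘ g = σ := funext hg
  refine ⟨Finsupp.single ⟨g, hf.continuous_iff.2 (hg' ▸ σ.continuous)⟩ 1, ?_⟩
  rw [push_single]
  congr 1
  ext x
  exact hg x

end Embedding

/-! ### The suspension and its isomorphism in homology. -/

/-- The non-Hausdorff suspension of a space: two points are added, and every neighbourhood of
one of them contains the whole space. -/
inductive Susp (X : Type) : Type
  | base : X → Susp X
  | pole : Bool → Susp X

namespace Susp

variable {X Y : Type} [TopologicalSpace X] [TopologicalSpace Y]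

instance : TopologicalSpace (Susp X) where
  IsOpen U := IsOpen (base ⁻¹' U) ∧ ∀ b, pole b ∈ U → ∀ x, base x ∈ U
  isOpen_univ := ⟨isOpen_univ, fun _ _ _ => trivial⟩
  isOpen_inter U V hU hV := ⟨hU.1.inter hV.1, fun b hb x => ⟨hU.2 b hb.1 x, hV.2 b hb.2 x⟩⟩
  isOpen_sUnion s hs := by
    refine ⟨?_, fun b ⟨U, hU, hb⟩ x => ⟨U, hU, (hs U hU).2 b hb x⟩⟩
    rw [Set.preimage_sUnion]
    exact isOpen_biUnion fun U hU => (hs U hU).1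

/-- The inclusion of a space in its suspension. -/
def baseMap (X : Type) [TopologicalSpace X] : C(X, Susp X) :=
  ⟨base, continuous_def.2 fun _ hU => hU.1⟩

omit [TopologicalSpace X] in
theorem base_injective : Function.Injective (base : X → Susp X) := fun _ _ h => by
  injection h

theorem isInducing_baseMap : Topology.IsInducing (baseMap X) := by
  refine ⟨le_antisymm (baseMap X).continuous.le_induced fun U hU => ?_⟩
  -- This image contains no pole, so the openness condition at the poles is vacuous.
  refine ⟨base '' U, ⟨?_, fun b hb => ?_⟩, Set.preimage_image_eq U base_injective⟩
  · rwa [Set.preimage_image_eq U base_injective]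
  · obtain ⟨x, -, hx⟩ := hb
    cases hx

/-- The open cones of the suspension. -/
def cone (X : Type) (b : Bool) : Set (Susp X) := {y | y ≠ pole !b}

theorem isOpen_cone (b : Bool) : IsOpen (cone X b) := by
  refine ⟨?_, fun _ _ _ => nofun⟩
  convert isOpen_univ
  exact Set.eq_univ_of_forall fun _ => nofun

omit [TopologicalSpace X] in
theorem exists_mem_cone (y : Susp X) : ∃ b, y ∈ cone X b := by
  cases y with
  | base x => exact ⟨true, nofun⟩
  | pole b => exact ⟨b, fun h => by injection h with h; cases b <;> cases h⟩

omit [TopologicalSpace X] in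
theorem pole_mem_cone (b : Bool) : pole b ∈ cone X b := fun h => by
  injection h with h; cases b <;> cases h

theorem cone_subset (b : Bool) (U : Set (Susp X)) (hU : IsOpen U) (hb : pole b ∈ U) :
    cone X b ⊆ U := by
  rintro (x | b') hy
  · exact hU.2 b hb x
  · have : b' = b := by
      by_contra h
      exact hy (by cases b <;> cases b' <;> simp_all)
    exact this ▸ hb

theorem range_baseMap : Set.range (baseMap X) = cone X true ∩ cone X false := by
  ext y
  constructor
  · rintro ⟨x, rfl⟩
    exact ⟨nofun, nofun⟩
  · rintro ⟨h1, h2⟩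
    cases y with
    | base x => exact ⟨x, rfl⟩
    | pole b => cases b <;> simp [cone] at h1 h2

theorem range_baseMap_subset (b : Bool) : Set.range (baseMap X) ⊆ cone X b := by
  rintro _ ⟨x, rfl⟩
  exact nofun

/-- Functoriality of the suspension. -/
def map (f : C(X, Y)) : C(Susp X, Susp Y) where
  toFun
    | base x => base (f x)
    | pole b => pole b
  continuous_toFun := continuous_def.2 fun _ hU =>
    ⟨hU.1.preimage f.continuous, fun b hb x => hU.2 b hb (f x)⟩

end Susp

/-- The suspension as a functor. -/
def suspFunctor : TopCat.{0} ⥤ TopCat.{0} where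
  obj X := TopCat.of (Susp X)
  map f := TopCat.ofHom (Susp.map f.hom)
  map_id X := by
    ext y
    cases y <;> rfl
  map_comp f g := by
    ext y
    cases y <;> rfl

section

variable (k : Type) [Field k] (X : Type) [TopologicalSpace X] {Y : Type} [TopologicalSpace Y]

open Susp

/-- The cone operators on the suspension. -/
abbrev poleOp (b : Bool) (n : ℕ) : Ch k (Susp X) n →ₗ[k] Ch k (Susp X) (n + 1) :=
  coneOp k (pole b) (cone X b) (cone_subset b) n

/-- The suspension of singular chains. -/
def suspCh (n : ℕ) : Ch k X n →ₗ[k] Ch k (Susp X) (n + 1) :=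
  (poleOp k X true n - poleOp k X false n) ∘ₗ push k (baseMap X) n

variable {X}

theorem suspCh_apply (n : ℕ) (c : Ch k X n) : suspCh k X n c =
    poleOp k X true n (push k (baseMap X) n c) - poleOp k X false n (push k (baseMap X) n c) :=
  rfl

theorem push_mem_cone (b : Bool) (n : ℕ) (c : Ch k X n) :
    push k (baseMap X) n c ∈ chainsIn k (cone X b) n :=
  push_mem_chainsIn k _ (range_baseMap_subset b) n c

theorem bdry_poleOp_push (b : Bool) (n : ℕ) (c : Ch k X (n + 1)) :
    bdry k _ (n + 1) (poleOp k X b (n + 1) (push k (baseMap X) (n + 1) c)) =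
      push k (baseMap X) (n + 1) c - poleOp k X b n (push k (baseMap X) n (bdry k X n c)) := by
  rw [bdry_coneOp k _ (push_mem_cone k b _ c), push_bdry]

/-- Both cones have `c` as base, and these two terms cancel in the difference. -/
theorem bdry_suspCh (n : ℕ) (c : Ch k X (n + 1)) :
    bdry k _ (n + 1) (suspCh k X (n + 1) c) = -suspCh k X n (bdry k X n c) := by
  rw [suspCh_apply, map_sub, bdry_poleOp_push, bdry_poleOp_push, suspCh_apply]
  abel

theorem suspCh_naturality (f : C(X, Y)) (n : ℕ) (c : Ch k X n) :
    push k (Susp.map f) (n + 1) (suspCh k X n c) = suspCh k Y n (push k f n c) := by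
  have : push k (Susp.map f) (n + 1) ∘ₗ suspCh k X n = suspCh k Y n ∘ₗ push k f n := by
    refine lhom_ext_one k fun σ => ?_
    have h {Z : Type} [TopologicalSpace Z] (σ : C(Splx n, Z)) (b) :
        Set.range ((baseMap Z).comp σ) ⊆ cone Z b :=
      (ContinuousMap.range_comp_subset _ _).trans (range_baseMap_subset b)
    simp only [LinearMap.comp_apply, suspCh_apply, push_single, map_sub,
      coneOp_single k _ _ (h _ _)]
    congr 2 <;>
    · ext x : 1
      rw [ContinuousMap.comp_apply]
      by_cases hx : x 0 = 1
      · rw [coneMap_of_eq _ _ _ _ hx, coneMap_of_eq _ _ _ _ hx]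
        rfl
      · rw [coneMap_of_ne _ _ _ _ hx, coneMap_of_ne _ _ _ _ hx]
        rfl
  exact LinearMap.congr_fun this c

theorem exists_push_of_mem_cones {n : ℕ} {c : Ch k (Susp X) n}
    (h1 : c ∈ chainsIn k (cone X true) n) (h2 : c ∈ chainsIn k (cone X false) n) :
    ∃ c', push k (baseMap X) n c' = c := by
  refine exists_push_eq k isInducing_baseMap ?_
  rw [chainsIn, range_baseMap]
  simp only [Set.subset_inter_iff]
  exact (Finsupp.supported_inter (M := k) (R := k) _ _).ge ⟨h1, h2⟩

/-- A chain on the suspension whose boundary is small is homologous to a sum of chains in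
the two cones. -/
theorem exists_decomposition {n : ℕ} (z : Ch k (Susp X) (n + 1))
    (hz : ∃ u ∈ chainsIn k (cone X true) n, ∃ v ∈ chainsIn k (cone X false) n,
      bdry k _ n z = u + v) :
    ∃ w, ∃ u ∈ chainsIn k (cone X true) (n + 1), ∃ v ∈ chainsIn k (cone X false) (n + 1),
      z = bdry k _ (n + 1) w + u + v := by
  have hs (n : ℕ) : small k (cone X) n =
      chainsIn k (cone X true) n ⊔ chainsIn k (cone X false) n := by
    rw [small, chainsIn, chainsIn, ← Finsupp.supported_union]
    congr 1
    ext σ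
    simp [or_comm]
  obtain ⟨u, hu, v, hv, huv⟩ := hz
  obtain ⟨w, hw⟩ := exists_sub_bdry_mem_small k (cone X) isOpen_cone exists_mem_cone n z (by
    rw [hs, huv]
    exact Submodule.add_mem_sup hu hv)
  rw [hs, Submodule.mem_sup] at hw
  obtain ⟨u, hu, v, hv, h⟩ := hw
  exact ⟨w, u, hu, v, hv, by rw [add_assoc, h]; abel⟩

/-- Surjectivity on homology. Up to a boundary, `z = u + v` with `u` and `v` in the two cones. Then
`∂u = -∂v` lies in both cones, hence comes from a cycle `x` of the base, and coning `u` and `v` off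
shows that `u + v` is homologous to the suspension of `x`. -/
theorem exists_suspCh_homologous (n : ℕ) (z : Ch k (Susp X) (n + 2))
    (hz : bdry k _ (n + 1) z = 0) :
    ∃ x, bdry k X n x = 0 ∧ ∃ w, z = suspCh k X (n + 1) x + bdry k _ (n + 2) w := by
  obtain ⟨w, u, hu, v, hv, rfl⟩ := exists_decomposition k z
    ⟨0, Submodule.zero_mem _, 0, Submodule.zero_mem _, by rw [hz, add_zero]⟩
  rw [map_add, map_add, bdry_bdry, zero_add] at hz
  have hv' : bdry k _ (n + 1) v = -bdry k _ (n + 1) u := (neg_eq_of_add_eq_zero_right hz).symm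
  obtain ⟨x, hx⟩ := exists_push_of_mem_cones k (bdry_mem_chainsIn k hu) (by
    rw [← neg_neg (bdry k _ (n + 1) u), ← hv']
    exact Submodule.neg_mem _ (bdry_mem_chainsIn k hv))
  refine ⟨x, ?_, w + poleOp k X true (n + 2) u + poleOp k X false (n + 2) v, ?_⟩
  · apply push_injective k (f := baseMap X) base_injective n
    exact (push_bdry k _ n x).trans (by rw [hx, bdry_bdry, map_zero])
  · have h1 := bdry_coneOp k (cone_subset true) hu
    have h2 := bdry_coneOp k (cone_subset false) hv
    rw [suspCh_apply, hx, map_add, map_add, h1, h2, hv', map_neg]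
    abel

/-- Injectivity on homology. If `y` is `u + v` up to a boundary, then `∂u` minus the upper cone on
`x` equals `-∂v` minus the lower cone on `x`. So it lies in the base, where its boundary is `-x`. -/
theorem exists_bdry_of_suspCh_eq (n : ℕ) (x : Ch k X (n + 1)) (hx : bdry k X n x = 0)
    (y : Ch k (Susp X) (n + 1 + 2)) (hy : bdry k _ (n + 1 + 1) y = suspCh k X (n + 1) x) :
    ∃ t, bdry k X (n + 1) t = x := by
  have hc (b : Bool) := coneOp_mem_chainsIn k (cone_subset b) (pole_mem_cone b)
    (push_mem_cone k b (n + 1) x)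
  obtain ⟨w, u, hu, v, hv, rfl⟩ := exists_decomposition k y
    ⟨_, hc true, _, Submodule.neg_mem _ (hc false), by rw [hy, suspCh_apply, sub_eq_add_neg]⟩
  rw [map_add, map_add, bdry_bdry, zero_add, suspCh_apply] at hy
  have ht : bdry k _ (n + 2) u - poleOp k X true (n + 1) (push k (baseMap X) (n + 1) x) =
      -bdry k _ (n + 2) v - poleOp k X false (n + 1) (push k (baseMap X) (n + 1) x) := by
    rw [eq_sub_of_add_eq hy]
    abel
  obtain ⟨t, h⟩ := exists_push_of_mem_cones k
    (Submodule.sub_mem _ (bdry_mem_chainsIn k hu) (hc true)) (by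
      rw [ht]
      exact Submodule.sub_mem _ (Submodule.neg_mem _ (bdry_mem_chainsIn k hv)) (hc false))
  refine ⟨-t, ?_⟩
  apply push_injective k (f := baseMap X) base_injective (n + 1)
  refine (push_bdry k (baseMap X) (n + 1) _).trans ?_
  rw [map_neg, h, map_neg, map_sub, bdry_bdry, bdry_poleOp_push, hx, map_zero, map_zero]
  simp

/-- The suspension of singular cycles. -/
def suspCyc (X : Type) [TopologicalSpace X] (n : ℕ) :
    Cyc k X n →ₗ[k] Cyc k (Susp X) (n + 1) :=
  (suspCh k X (n + 1)).restrict fun z hz => by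
    rw [LinearMap.mem_ker] at hz ⊢
    rw [bdry_suspCh, hz, map_zero, neg_zero]

theorem exists_suspension_equiv (X : TopCat.{0}) (n : ℕ) :
    ∃ e : (singH k (n + 1)).obj X ≃ₗ[k] (singH k (n + 2)).obj (TopCat.of (Susp X)),
      ∀ z, e (cls k X n z) = cls k (TopCat.of (Susp X)) (n + 1) (suspCyc k X n z) := by
  refine LinearMap.exists_equiv_of_surjective (cls k X n) (cls k (TopCat.of (Susp X)) (n + 1))
    (suspCyc k X n) (cls_surjective k X n) (fun z => ?_) fun y => ?_
  · rw [cls_eq_zero_iff, cls_eq_zero_iff]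
    constructor
    · rintro ⟨y, hy⟩
      exact exists_bdry_of_suspCh_eq k (X := X) n z.1 z.2 y hy
    · rintro ⟨w, hw⟩
      refine ⟨-suspCh k X (n + 2) w, ?_⟩
      refine (map_neg _ _).trans ((congrArg Neg.neg (bdry_suspCh k (n + 1) w)).trans ?_)
      rw [neg_neg, hw]
      rfl
  · obtain ⟨z, rfl⟩ := cls_surjective k (TopCat.of (Susp X)) (n + 1) y
    obtain ⟨x, hx, w, hw⟩ := exists_suspCh_homologous k n z.1 z.2
    refine ⟨⟨x, hx⟩, ?_⟩
    rw [← sub_eq_zero, ← map_sub, cls_eq_zero_iff]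
    refine ⟨-w, (map_neg _ _).trans ?_⟩
    refine (eq_sub_of_add_eq' hw.symm).symm ▸ ?_
    rw [neg_sub]
    rfl

/-- The suspension isomorphism. -/
def suspIso (n : ℕ) : singH k (n + 1) ≅ suspFunctor ⋙ singH k (n + 2) :=
  NatIso.ofComponents (fun X => (exists_suspension_equiv k X n).choose.toModuleIso) fun {X Y} f => by
    ext y
    obtain ⟨z, rfl⟩ := cls_surjective k X n y
    have hX := (exists_suspension_equiv k X n).choose_spec z
    have hY := (exists_suspension_equiv k Y n).choose_spec (pushCyc k f.hom n z)
    change (exists_suspension_equiv k Y n).choose (((singH k (n + 1)).map f).hom _) =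
      ((singH k (n + 2)).map (suspFunctor.map f)).hom ((exists_suspension_equiv k X n).choose _)
    rw [hX, cls_naturality, hY]
    refine Eq.trans ?_ (cls_naturality k (suspFunctor.map f) (n + 1) (suspCyc k X n z)).symm
    congr 1
    exact Subtype.ext (suspCh_naturality k f.hom (n + 1) z.1).symm

end

/-! ### First homology of a quotient by a covering action. -/

instance (n : ℕ) : ContractibleSpace (Splx n) :=
  (convex_stdSimplex ℝ _).contractibleSpace Set.Nonempty.of_subtype

/-- With contractibility, this is what lifting singular simplices through a covering requires. -/
instance (n : ℕ) : LocallyPathConnectedSpace (Splx n) := by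
  refine .of_bases (fun x => Metric.nhds_basis_ball) fun x r hr => ?_
  have h : IsPathConnected (Metric.ball x.1 r ∩ stdSimplex ℝ (Fin (n + 1))) :=
    ((convex_ball x.1 r).inter (convex_stdSimplex ℝ _)).isPathConnected
      ⟨x.1, Metric.mem_ball_self hr, x.2⟩
  have h2 := Topology.IsInducing.subtypeVal.isPathConnected_iff (F := Metric.ball x r)
    (X := Splx n)
  rw [h2]
  convert h using 1
  ext y
  constructor
  · rintro ⟨y, hy, rfl⟩
    exact ⟨hy, y.2⟩
  · rintro ⟨hy, hy'⟩
    exact ⟨⟨y, hy'⟩, hy, rfl⟩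

/-- A field is additively rigid if all additive maps between its vector spaces are linear. -/
def AdditivelyRigid (k : Type) [Field k] : Prop :=
  ∀ ⦃A M : Type⦄ [AddCommGroup A] [AddCommGroup M] [Module k A] [Module k M] (f : A →+ M)
    (r : k) (a : A), f (r • a) = r • f a

section Edge

variable {X Y : Type} [TopologicalSpace X] [TopologicalSpace Y] (k : Type) [Field k]

theorem face_vertex {n : ℕ} (i : Fin (n + 2)) (j : Fin (n + 1)) :
    face i (stdSimplex.vertex j) = stdSimplex.vertex (i.succAbove j) :=
  stdSimplex.map_vertex _ _

theorem bdry_edge (τ : C(Splx 1, X)) : bdry k X 0 (Finsupp.single τ 1) =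
    Finsupp.single (ContinuousMap.const _ (τ (stdSimplex.vertex 1))) 1 -
      Finsupp.single (ContinuousMap.const _ (τ (stdSimplex.vertex 0))) 1 := by
  have h (i : Fin 2) : τ.comp (face i) =
      ContinuousMap.const _ (τ (stdSimplex.vertex (i.succAbove 0))) := by
    ext x
    rw [ContinuousMap.comp_apply, ContinuousMap.const_apply, ← face_vertex]
    congr 2
    exact Subsingleton.elim _ _
  rw [bdry_single, Fin.sum_univ_two, h, h]
  simp [sub_eq_add_neg]

theorem exists_edge [PathConnectedSpace X] (x y : X) :
    ∃ τ : C(Splx 1, X), τ (stdSimplex.vertex 0) = x ∧ τ (stdSimplex.vertex 1) = y := by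
  let γ := PathConnectedSpace.somePath x y
  refine ⟨γ.toContinuousMap.comp ⟨stdSimplexHomeomorphUnitInterval,
    stdSimplexHomeomorphUnitInterval.continuous⟩, ?_, ?_⟩
  · exact (congrArg γ stdSimplexHomeomorphUnitInterval_zero).trans γ.source
  · exact (congrArg γ stdSimplexHomeomorphUnitInterval_one).trans γ.target

end Edge

section Covering

variable {A E B : Type} [AddCommGroup A] [TopologicalSpace E] [TopologicalSpace B]
  [AddAction A E] {p : C(E, B)} (hp : IsAddQuotientCoveringMap p A) {c : E → A}
  (hc : ∀ (a : A) (x : E), c (a +ᵥ x) = a + c x)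

include hp in
theorem exists_lift {n : ℕ} (σ : C(Splx n, B)) : ∃ τ : C(Splx n, E), p.comp τ = σ := by
  obtain ⟨e, he⟩ := hp.surjective (σ (stdSimplex.vertex 0))
  obtain ⟨τ, ⟨-, hτ⟩, -⟩ := hp.isCoveringMap.existsUnique_continuousMap_lifts σ _ e he
  exact ⟨τ, ContinuousMap.ext (congrFun hτ)⟩

include hp in
theorem exists_vadd_eq {n : ℕ} {τ τ' : C(Splx n, E)} (h : p.comp τ = p.comp τ') :
    ∃ a : A, ∀ x, τ x = a +ᵥ τ' x := by
  obtain ⟨a, ha⟩ := hp.apply_eq_iff_mem_orbit.1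
    (DFunLike.congr_fun h (stdSimplex.vertex 0))
  have := hp.toContinuousConstVAdd
  refine ⟨a, congrFun (hp.isCoveringMap.eq_of_comp_eq τ.continuous
    (τ'.continuous.const_vadd a) ?_ (stdSimplex.vertex 0) ha.symm)⟩
  funext x
  exact (DFunLike.congr_fun h x).trans (hp.map_vadd a).symm

variable (c) in
/-- The period of a singular edge in the base of a covering. -/
def period (σ : C(Splx 1, B)) : A :=
  c ((exists_lift hp σ).choose (stdSimplex.vertex 1)) -
    c ((exists_lift hp σ).choose (stdSimplex.vertex 0))

-- Two lifts differ by a translation, which changes both endpoint values of `c` by the same amount.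
include hc in
theorem period_comp (τ : C(Splx 1, E)) : period hp c (p.comp τ) =
    c (τ (stdSimplex.vertex 1)) - c (τ (stdSimplex.vertex 0)) := by
  obtain ⟨a, ha⟩ := exists_vadd_eq hp (exists_lift hp (p.comp τ)).choose_spec
  rw [period, ha, ha, hc, hc, add_sub_add_left_eq_sub]

variable (k : Type) [Field k] [Module k A]

variable (c) in
/-- The period as a linear map on singular chains. -/
def periodMap : Ch k B 1 →ₗ[k] A := Finsupp.linearCombination k (period hp c)

@[simp]
theorem periodMap_single (σ : C(Splx 1, B)) :
    periodMap hp c k (Finsupp.single σ 1) = period hp c σ := by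
  simp [periodMap]

-- After lifting a triangle, the three endpoint differences telescope.
include hc in
theorem periodMap_bdry (w : Ch k B 2) : periodMap hp c k (bdry k B 1 w) = 0 := by
  have : periodMap hp c k ∘ₗ bdry k B 1 = 0 := by
    refine lhom_ext_one k fun σ => ?_
    obtain ⟨τ, rfl⟩ := exists_lift hp σ
    simp only [LinearMap.comp_apply, bdry_single, map_sum, map_smul, periodMap_single,
      ContinuousMap.comp_assoc, period_comp hp hc, ContinuousMap.comp_apply, face_vertex]
    refine (Fin.sum_univ_three _).trans ?_
    have h01 : Fin.succAbove (0 : Fin 3) 1 = 2 := rfl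
    have h11 : Fin.succAbove (1 : Fin 3) 1 = 2 := rfl
    have h20 : Fin.succAbove (2 : Fin 3) 0 = 0 := rfl
    have h21 : Fin.succAbove (2 : Fin 3) 1 = 1 := rfl
    have h00 : Fin.succAbove (0 : Fin 3) 0 = 1 := rfl
    have h10 : Fin.succAbove (1 : Fin 3) 0 = 0 := rfl
    simp [h00, h01, h10, h11, h20, h21]
  exact LinearMap.congr_fun this w

variable [PathConnectedSpace E]
  (hE : ∀ z, bdry k E 0 z = 0 → ∃ w, bdry k E 1 w = z)

include hc in
theorem exists_cycle_period_eq (a : A) : ∃ z, bdry k B 0 z = 0 ∧ periodMap hp c k z = a := by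
  obtain ⟨e⟩ := (inferInstance : Nonempty E)
  obtain ⟨τ, h0, h1⟩ := exists_edge e (a +ᵥ e)
  refine ⟨Finsupp.single (p.comp τ) 1, ?_, ?_⟩
  · rw [bdry_edge, ContinuousMap.comp_apply, ContinuousMap.comp_apply, h0, h1, hp.map_vadd,
      sub_self]
  · rw [periodMap_single, period_comp hp hc, h0, h1, hc, add_sub_cancel_right]

-- Modulo boundaries, the class of an edge is shown to be a linear function of its period plus a
-- function of its boundary; both contributions vanish for a cycle of period zero.
include hc hE in
theorem exists_bdry_of_period_eq_zero (hk : AdditivelyRigid k) (z : Ch k B 1)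
    (hz : bdry k B 0 z = 0) (hz' : periodMap hp c k z = 0) : ∃ w, bdry k B 1 w = z := by
  have := hp.toContinuousConstVAdd
  obtain ⟨e⟩ := (inferInstance : Nonempty E)
  choose h h0 h1 using exists_edge e
  let N : Submodule k (Ch k B 1) := LinearMap.range (bdry k B 1)
  -- The class of the projected path from `e` to `x`. It does not depend on the path, since cycles
  -- of `E` bound.
  let H (x : E) : Ch k B 1 ⧸ N := N.mkQ (push k p 1 (Finsupp.single (h x) 1))
  have hcyc (z : Ch k E 1) (hz : bdry k E 0 z = 0) : N.mkQ (push k p 1 z) = 0 := by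
    obtain ⟨w, rfl⟩ := hE z hz
    rw [push_bdry, Submodule.mkQ_apply, Submodule.Quotient.mk_eq_zero]
    exact ⟨_, rfl⟩
  let t (a : A) : C(E, E) := ⟨(a +ᵥ ·), continuous_const_vadd a⟩
  have ht (a : A) (τ : C(Splx 1, E)) : p.comp ((t a).comp τ) = p.comp τ := by
    ext x
    exact hp.map_vadd a
  -- The path from `e` to `a + x` is compared with the one through `a + e` whose second half is the
  -- translate of the path to `x`; translation does not change projections.
  have hH (a : A) (x : E) : H (a +ᵥ x) = H (a +ᵥ e) + H x := by
    have h2 := hcyc (Finsupp.single (h (a +ᵥ x)) 1 - Finsupp.single (h (a +ᵥ e)) 1 -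
      Finsupp.single ((t a).comp (h x)) 1) (by
        rw [map_sub, map_sub, bdry_edge, bdry_edge, bdry_edge]
        simp only [ContinuousMap.comp_apply, h0, h1]
        simp [t])
    rw [map_sub, map_sub, map_sub, map_sub, push_single _ _ _ ((t a).comp (h x)), ht,
      ← push_single, sub_sub, sub_eq_zero] at h2
    exact h2
  have hτ (τ : C(Splx 1, E)) : N.mkQ (Finsupp.single (p.comp τ) 1) =
      H (τ (stdSimplex.vertex 1)) - H (τ (stdSimplex.vertex 0)) := by
    have h2 := hcyc (Finsupp.single τ 1 - (Finsupp.single (h (τ (stdSimplex.vertex 1))) 1 -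
      Finsupp.single (h (τ (stdSimplex.vertex 0))) 1)) (by
        rw [map_sub, map_sub, bdry_edge, bdry_edge, bdry_edge]
        simp only [h0, h1]
        abel)
    rw [map_sub, map_sub, map_sub, map_sub, sub_eq_zero, push_single] at h2
    exact h2
  let l : A →+ Ch k B 1 ⧸ N := AddMonoidHom.mk' (fun a => H (a +ᵥ e)) fun a b => by
    rw [add_vadd, hH]
  -- The one use of rigidity: a priori `l` is only additive.
  let l' : A →ₗ[k] Ch k B 1 ⧸ N := { l with map_smul' := hk l }
  -- Each fibre has a point where `c` vanishes; measured from it, `c` is the translation parameter.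
  have hrep (b : B) : ∃ x, p x = b ∧ c x = 0 := by
    obtain ⟨x, rfl⟩ := hp.surjective b
    exact ⟨-c x +ᵥ x, hp.map_vadd _, by rw [hc, neg_add_cancel]⟩
  choose rep hp_rep hc_rep using hrep
  have hHx (x : E) : H x = l (c x) + H (rep (p x)) := by
    obtain ⟨a, ha⟩ := hp.apply_eq_iff_mem_orbit.1 (hp_rep (p x)).symm
    have ha' : a +ᵥ rep (p x) = x := ha
    have hcx : c x = a := by
      conv_lhs => rw [← ha', hc, hc_rep, add_zero]
    rw [hcx]
    conv_lhs => rw [← ha', hH]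
    rfl
  let s : Ch k B 0 →ₗ[k] Ch k B 1 ⧸ N := Finsupp.linearCombination k fun σ => H (rep (σ default))
  have key : N.mkQ = l' ∘ₗ periodMap hp c k + s ∘ₗ bdry k B 0 := by
    refine lhom_ext_one k fun σ => ?_
    obtain ⟨τ, rfl⟩ := exists_lift hp σ
    have hs (b : B) : s (Finsupp.single (ContinuousMap.const _ b) 1) = H (rep b) := by simp [s]
    have hl (a b : A) : l' (a - b) = l a - l b := map_sub l a b
    rw [LinearMap.add_apply, LinearMap.comp_apply, LinearMap.comp_apply, periodMap_single,
      period_comp hp hc, bdry_edge, hτ, hHx, hHx (τ _), map_sub s, hs, hs, hl]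
    simp only [ContinuousMap.comp_apply]
    abel
  have hz2 := LinearMap.congr_fun key z
  rw [LinearMap.add_apply, LinearMap.comp_apply, LinearMap.comp_apply, hz, hz', map_zero,
    map_zero, add_zero, Submodule.mkQ_apply, Submodule.Quotient.mk_eq_zero] at hz2
  exact hz2

end Covering

end SingularChains

/-! ### Homotopies from specialization; the infinite join and its quotient. -/

open Classical in
/-- If every open set containing `g x` contains `f x`, then `f` and `g` are homotopic. -/
theorem ContinuousMap.homotopic_of_specializes {X Y : Type*} [TopologicalSpace X]
    [TopologicalSpace Y] (f g : C(X, Y)) (h : ∀ U : Set Y, IsOpen U → g ⁻¹' U ⊆ f ⁻¹' U) :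
    f.Homotopic g := by
  refine ⟨⟨⟨fun p => if p.1 = 1 then g p.2 else f p.2, continuous_def.2 fun U hU => ?_⟩,
    fun x => ?_, fun x => ?_⟩⟩
  · have h1 : IsOpen ({p : unitInterval × X | p.1 ≠ 1} ∩ Prod.snd ⁻¹' (f ⁻¹' U)) :=
      (isOpen_ne_fun continuous_fst continuous_const).inter
        ((hU.preimage f.continuous).preimage continuous_snd)
    convert h1.union ((hU.preimage g.continuous).preimage continuous_snd) using 1
    ext ⟨t, x⟩
    have := @h U hU x
    by_cases ht : t = 1 <;> simp_all
  · simp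
  · simp

namespace SingularChains

open OrderedChains

/-- On homology the map factors through a point, which has none in positive degrees. -/
theorem exists_bdry_eq_push_of_nullhomotopic (k : Type) [Field k] {X Y : TopCat.{0}} (f : C(X, Y))
    (hf : f.Nullhomotopic) (n : ℕ) (z : Ch k X (n + 1)) (hz : bdry k X n z = 0) :
    ∃ w, bdry k Y (n + 1) w = push k f (n + 1) z := by
  obtain ⟨y, ⟨H⟩⟩ := hf
  let g : TopCat.of PUnit.{1} ⟶ Y := TopCat.ofHom (ContinuousMap.const _ y)
  let h : X ⟶ TopCat.of PUnit.{1} := TopCat.ofHom (ContinuousMap.const _ PUnit.unit)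
  have h1 : (singH k (n + 1)).map (TopCat.ofHom f) = (singH k (n + 1)).map (h ≫ g) :=
    TopCat.Homotopy.congr_homologyMap_singularChainComplexFunctor
      (f := TopCat.ofHom f) (g := h ≫ g) H (ModuleCat.of k k) (n + 1)
  have h2 : Limits.IsZero ((singH k (n + 1)).obj (TopCat.of PUnit.{1})) :=
    AlgebraicTopology.isZero_singularHomologyFunctor_of_totallyDisconnectedSpace
      (ModuleCat.{0} k) (n + 1) _ _ n.succ_ne_zero
  have h3 : (singH k (n + 1)).map (TopCat.ofHom f) = 0 := by
    rw [h1, Functor.map_comp, h2.eq_zero_of_tgt ((singH k (n + 1)).map h), Limits.zero_comp]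
  have h4 := cls_naturality k (TopCat.ofHom f) n ⟨z, hz⟩
  rw [h3] at h4
  exact (cls_eq_zero_iff k Y n _).1 h4.symm

/-- The infinite join of a set `A`, as the poset of finite nonempty partial functions from `ℕ`
to `A`. -/
def Join (A : Type) : Type :=
  {f : ℕ → Option A // (∃ n, (f n).isSome) ∧ ∃ N, ∀ n, N ≤ n → f n = none}

namespace Join

variable {A A' : Type}

/-- The value of a partial function. -/
def val (f : Join A) (n : ℕ) : Option A := f.1 n

theorem ext {f g : Join A} (h : ∀ n, f.val n = g.val n) : f = g := Subtype.ext (funext h)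

/-- Extension of partial functions. -/
def Extends (g f : Join A) : Prop := ∀ n a, f.val n = some a → g.val n = some a

theorem Extends.refl (f : Join A) : f.Extends f := fun _ _ h => h

theorem Extends.trans {f g h : Join A} (h1 : f.Extends g) (h2 : g.Extends h) : f.Extends h :=
  fun n a ha => h1 n a (h2 n a ha)

/-- The open sets are those closed under restriction of partial functions. -/
instance : TopologicalSpace (Join A) where
  IsOpen U := ∀ f ∈ U, ∀ g, f.Extends g → g ∈ U
  isOpen_univ := fun _ _ _ _ => trivial
  isOpen_inter _ _ hU hV := fun f hf g hg => ⟨hU f hf.1 g hg, hV f hf.2 g hg⟩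
  isOpen_sUnion _ hs := fun f ⟨U, hU, hf⟩ g hg => ⟨U, hU, hs U hU f hf g hg⟩

theorem continuous_of_extends {φ : Join A → Join A'}
    (h : ∀ f g, f.Extends g → (φ f).Extends (φ g)) : Continuous φ :=
  continuous_def.2 fun _ hU f hf g hg => hU _ hf _ (h f g hg)

/-- Postcomposition of partial functions with a map. -/
def map (φ : A → A') (f : Join A) : Join A' :=
  ⟨fun n => (f.val n).map φ, by
    obtain ⟨n, hn⟩ := f.2.1
    exact ⟨n, by rw [Option.isSome_map]; exact hn⟩, by
    obtain ⟨N, hN⟩ := f.2.2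
    exact ⟨N, fun n hn => by
      change Option.map φ (f.1 n) = none
      rw [hN n hn]
      rfl⟩⟩

theorem val_map (φ : A → A') (f : Join A) (n : ℕ) : (map φ f).val n = (f.val n).map φ := rfl

theorem continuous_map (φ : A → A') : Continuous (map φ) := by
  refine continuous_of_extends fun f g h n a ha => ?_
  rw [val_map, Option.map_eq_some_iff] at ha ⊢
  obtain ⟨b, hb, rfl⟩ := ha
  exact ⟨b, h n b hb, rfl⟩

theorem exists_first (f : Join A) : ∃ n a, f.val n = some a ∧ ∀ m < n, f.val m = none := by
  classical
  obtain ⟨a, ha⟩ := Option.isSome_iff_exists.1 (Nat.find_spec f.2.1)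
  refine ⟨_, a, ha, fun m hm => ?_⟩
  have h : f.1 m = none := by simpa using Nat.find_min f.2.1 hm
  exact h

/-- The value of a partial function at the minimum of its domain. -/
def first (f : Join A) : A := f.exists_first.choose_spec.choose

theorem exists_val_eq_first (f : Join A) :
    ∃ n, f.val n = some f.first ∧ ∀ m < n, f.val m = none :=
  ⟨_, f.exists_first.choose_spec.choose_spec⟩

theorem first_eq {f : Join A} {n : ℕ} {a : A} (h : f.val n = some a)
    (h' : ∀ m < n, f.val m = none) : f.first = a := by
  obtain ⟨n', h1, h2⟩ := f.exists_val_eq_first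
  rcases lt_trichotomy n' n with hlt | rfl | hgt
  · exact absurd (h1.symm.trans (h' _ hlt)) (by simp)
  · exact Option.some_injective _ (h1.symm.trans h)
  · exact absurd (h.symm.trans (h2 _ hgt)) (by simp)

theorem first_map (φ : A → A') (f : Join A) : (map φ f).first = φ f.first := by
  obtain ⟨n, a, ha, hn⟩ := f.exists_first
  rw [first_eq ha hn]
  exact first_eq (by rw [val_map, ha]; rfl) fun m hm => by rw [val_map, hn m hm]; rfl

section Action

variable [AddCommGroup A]

instance : AddAction A (Join A) where
  vadd a := map (a + ·)
  zero_vadd f := ext fun n => by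
    change (f.val n).map (0 + ·) = _
    cases f.val n <;> simp
  add_vadd a b f := ext fun n => by
    change (f.val n).map (a + b + ·) = ((f.val n).map (b + ·)).map (a + ·)
    cases f.val n <;> simp [add_assoc]

theorem val_vadd (a : A) (f : Join A) (n : ℕ) : (a +ᵥ f).val n = (f.val n).map (a + ·) := rfl

/-- This is the equivariance required of `c` in the period construction; no continuity of `first` is
needed. -/
theorem first_vadd (a : A) (f : Join A) : (a +ᵥ f).first = a + f.first := first_map _ f

end Action

/-- The partial functions whose domain is bounded by `N`. -/
def bounded (A : Type) (N : ℕ) : Set (Join A) := {f | ∀ n, N ≤ n → f.val n = none}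

theorem isOpen_bounded (N : ℕ) : IsOpen (bounded A N) := fun f hf g hg n hn => by
  by_contra h
  obtain ⟨a, ha⟩ := Option.ne_none_iff_exists'.1 h
  exact absurd ((hg n a ha).symm.trans (hf n hn)) (by simp)

theorem bounded_mono : Monotone (bounded A) := fun _ _ h _ hf n hn => hf n (h.trans hn)

theorem exists_mem_bounded (f : Join A) : ∃ N, f ∈ bounded A N := f.2.2

open Classical in
/-- Adjoin the value `a` at `N`. -/
def adjoin (N : ℕ) (a : A) (f : Join A) : Join A :=
  ⟨Function.update f.val N (some a), ⟨N, by simp⟩, by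
    obtain ⟨M, hM⟩ := f.2.2
    refine ⟨max M (N + 1), fun n hn => ?_⟩
    rw [Function.update_of_ne (by lia)]
    exact hM n (by lia)⟩

open Classical in
/-- The partial function with the only value `a` at `N`. -/
def single (N : ℕ) (a : A) : Join A :=
  ⟨Function.update (fun _ => none) N (some a), ⟨N, by simp⟩, N + 1, fun n hn => by
    rw [Function.update_of_ne (by lia)]⟩

/-- The position `N` is unused by these functions, so `f ≤ f ∪ {N ↦ a} ≥ {N ↦ a}` is a zigzag of
comparable maps, and comparable maps are homotopic. -/
theorem nullhomotopic_bounded (N : ℕ) (a : A) :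
    (⟨Subtype.val, continuous_subtype_val⟩ : C(bounded A N, Join A)).Homotopic
      (ContinuousMap.const _ (single N a)) := by
  have hadj : Continuous fun f : bounded A N => adjoin N a f.1 := by
    refine (continuous_of_extends (φ := adjoin N a) fun f g h n b hb => ?_).comp
      continuous_subtype_val
    change Function.update g.val N (some a) n = some b at hb
    change Function.update f.val N (some a) n = some b
    by_cases hn : n = N
    · subst hn
      simpa using hb
    · rw [Function.update_of_ne hn] at hb ⊢
      exact h n b hb
  let φ : C(bounded A N, Join A) := ⟨_, hadj⟩
  have h1 : (⟨Subtype.val, continuous_subtype_val⟩ : C(bounded A N, Join A)).Homotopic φ := by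
    refine ContinuousMap.homotopic_of_specializes _ _ fun U hU f hf => hU _ hf _ fun n b hb => ?_
    change Function.update f.1.val N (some a) n = some b
    rw [Function.update_of_ne, ← hb]
    · rfl
    · rintro rfl
      exact absurd ((f.2 n le_rfl).symm.trans hb) (by simp)
  have h2 : (ContinuousMap.const _ (single N a)).Homotopic φ := by
    refine ContinuousMap.homotopic_of_specializes _ _ fun U hU f hf => hU _ hf _ fun n b hb => ?_
    change Function.update (fun _ => none) N (some a) n = some b at hb
    change Function.update f.1.val N (some a) n = some b
    by_cases hn : n = N
    · subst hn
      simpa using hb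
    · rw [Function.update_of_ne hn] at hb
      cases hb
  exact h1.trans h2.symm

instance [Nonempty A] : PathConnectedSpace (Join A) where
  nonempty := ‹Nonempty A›.map (single 0)
  joined f g := by
    obtain ⟨a⟩ := ‹Nonempty A›
    obtain ⟨M, hM⟩ := exists_mem_bounded f
    obtain ⟨N, hN⟩ := exists_mem_bounded g
    obtain ⟨H⟩ := nullhomotopic_bounded (max M N) a
    have h1 : Joined f (single (max M N) a) :=
      ⟨H.evalAt ⟨f, bounded_mono (le_max_left M N) hM⟩⟩
    have h2 : Joined g (single (max M N) a) :=
      ⟨H.evalAt ⟨g, bounded_mono (le_max_right M N) hN⟩⟩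
    exact h1.trans h2.symm

theorem exists_range_subset_bounded {n : ℕ} (σ : C(Splx n, Join A)) :
    ∃ N, Set.range σ ⊆ bounded A N := by
  obtain ⟨N, hN⟩ := (isCompact_univ (X := Splx n)).elim_directed_cover
    (fun N => σ ⁻¹' bounded A N) (fun N => (isOpen_bounded N).preimage σ.continuous)
    (fun x _ => Set.mem_iUnion.2 (exists_mem_bounded (σ x)))
    (Monotone.directed_le fun _ _ h => Set.preimage_mono (bounded_mono h))
  exact ⟨N, by rintro _ ⟨x, rfl⟩; exact hN trivial⟩

/-- By compactness, the finitely many simplices of `z` lie in one bounded part, whose inclusion is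
nullhomotopic. -/
theorem exists_bdry_eq [Nonempty A] (k : Type) [Field k] (n : ℕ) (z : Ch k (Join A) (n + 1))
    (hz : bdry k _ n z = 0) : ∃ w, bdry k _ (n + 1) w = z := by
  choose N hN using fun σ : C(Splx (n + 1), Join A) => exists_range_subset_bounded σ
  obtain ⟨M, hM⟩ : ∃ M, ∀ σ ∈ z.support, Set.range σ ⊆ bounded A M :=
    ⟨z.support.sup N, fun σ hσ => (hN σ).trans (bounded_mono (Finset.le_sup hσ))⟩
  obtain ⟨a⟩ := ‹Nonempty A›
  let i : C(bounded A M, Join A) := ⟨Subtype.val, continuous_subtype_val⟩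
  have hi : Set.range i = bounded A M := Subtype.range_coe
  obtain ⟨z', rfl⟩ := exists_push_eq k (f := i) Topology.IsInducing.subtypeVal (c := z) (by
    refine (Finsupp.mem_supported k z).2 fun σ hσ => ?_
    change Set.range σ ⊆ Set.range i
    rw [hi]
    exact hM σ hσ)
  refine exists_bdry_eq_push_of_nullhomotopic k (X := TopCat.of (bounded A M))
    (Y := TopCat.of (Join A)) i ⟨_, nullhomotopic_bounded M a⟩ n z' ?_
  exact push_injective k (f := i) Subtype.val_injective n (by rw [push_bdry, hz, map_zero])

variable (A) [AddCommGroup A]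

/-- The classifying space of `A`, as the quotient of the infinite join. -/
abbrev Classifying : Type := Quotient (AddAction.orbitRel A (Join A))

/-- The projection to the classifying space. -/
def proj : C(Join A, Classifying A) := ⟨Quotient.mk _, continuous_quotient_mk'⟩

theorem isAddQuotientCoveringMap_proj : IsAddQuotientCoveringMap (proj A) A where
  toIsQuotientMap := isQuotientMap_quotient_mk'
  continuous_const_vadd a := continuous_map _
  apply_eq_iff_mem_orbit := Quotient.eq''
  disjoint e := by
    -- The smallest neighbourhood of `e`. If it contains `f` and `a + f`, both agree with `e` at a
    -- point of their common domain, so `a = 0`.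
    refine ⟨{f | e.Extends f}, IsOpen.mem_nhds (fun f hf g hg => hf.trans hg) (Extends.refl e),
      fun a => ?_⟩
    rintro ⟨_, ⟨f, hf, rfl⟩, hf'⟩
    obtain ⟨n, v, hv, -⟩ := f.exists_first
    have h1 := hf n v hv
    have h2 := hf' n (a + v) (by change (a +ᵥ f).val n = _; rw [val_vadd, hv]; rfl)
    rw [h1] at h2
    exact right_eq_add.1 (Option.some_injective _ h2)

variable {A} [AddCommGroup A']

/-- The map of classifying spaces induced by a homomorphism. -/
def classifyingMap (φ : A →+ A') : C(Classifying A, Classifying A') where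
  toFun := Quotient.map (map φ) (by
    rintro _ f ⟨a, rfl⟩
    refine ⟨φ a, ext fun n => ?_⟩
    change ((f.val n).map φ).map (φ a + ·) = ((f.val n).map (a + ·)).map φ
    cases f.val n <;> simp)
  continuous_toFun := (isAddQuotientCoveringMap_proj A).toIsQuotientMap.continuous_iff.2
    ((proj A').continuous.comp (continuous_map φ))

theorem classifyingMap_proj (φ : A →+ A') (f : Join A) :
    classifyingMap φ (proj A f) = proj A' (map φ f) := rfl

end Join

/-! ### Spaces with prescribed homology, functorially. -/

section

open Join

/-- The classifying space as a functor on vector spaces. -/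
def classifyingFunctor (k : Type) [Field k] : ModuleCat.{0} k ⥤ TopCat.{0} where
  obj A := TopCat.of (Classifying A)
  map φ := TopCat.ofHom (classifyingMap φ.hom.toAddMonoidHom)
  map_id A := by
    ext x
    obtain ⟨f, rfl⟩ := (isAddQuotientCoveringMap_proj A).surjective x
    change classifyingMap (AddMonoidHom.id A) (proj A f) = proj A f
    rw [classifyingMap_proj]
    refine congrArg (proj A) (Join.ext fun n => ?_)
    rw [val_map]
    cases f.val n <;> rfl
  map_comp {A B C} φ ψ := by
    ext x
    obtain ⟨f, rfl⟩ := (isAddQuotientCoveringMap_proj A).surjective x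
    change classifyingMap (φ ≫ ψ).hom.toAddMonoidHom (proj A f) =
      classifyingMap ψ.hom.toAddMonoidHom (classifyingMap φ.hom.toAddMonoidHom (proj A f))
    rw [classifyingMap_proj, classifyingMap_proj, classifyingMap_proj]
    refine congrArg (proj C) (Join.ext fun n => ?_)
    simp only [val_map]
    cases f.val n <;> rfl

variable {k : Type} [Field k]

/-- The period map of the classifying space. -/
abbrev classifyingPeriod (A : ModuleCat.{0} k) : Ch k (Classifying A) 1 →ₗ[k] A :=
  periodMap (isAddQuotientCoveringMap_proj A) Join.first k

/-- The induced map lifts to the joins, where it commutes with `first`. -/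
theorem classifyingPeriod_naturality {A A' : ModuleCat.{0} k} (φ : A ⟶ A')
    (z : Ch k (Classifying A) 1) :
    classifyingPeriod A' (push k (classifyingMap φ.hom.toAddMonoidHom) 1 z) =
      φ.hom (classifyingPeriod A z) := by
  have : classifyingPeriod A' ∘ₗ push k (classifyingMap φ.hom.toAddMonoidHom) 1 =
      φ.hom ∘ₗ classifyingPeriod A := by
    refine lhom_ext_one k fun σ => ?_
    obtain ⟨τ, rfl⟩ := exists_lift (isAddQuotientCoveringMap_proj A) σ
    have h : (classifyingMap φ.hom.toAddMonoidHom).comp ((proj A).comp τ) =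
        (proj A').comp ((⟨_, continuous_map φ.hom⟩ : C(Join A, Join A')).comp τ) := rfl
    rw [LinearMap.comp_apply, push_single, h, LinearMap.comp_apply, periodMap_single,
      periodMap_single, period_comp _ first_vadd, period_comp _ first_vadd, map_sub,
      ← first_map φ.hom, ← first_map φ.hom]
    rfl
  exact LinearMap.congr_fun this z

theorem exists_classifying_equiv (hk : AdditivelyRigid k) (A : ModuleCat.{0} k) :
    ∃ e : (singH k 1).obj (TopCat.of (Classifying A)) ≃ₗ[k] A,
      ∀ z, e (cls k (TopCat.of (Classifying A)) 0 z) = classifyingPeriod A z := by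
  have hE (z) (hz : bdry k (Join A) 0 z = 0) := Join.exists_bdry_eq (A := A) k 0 z hz
  refine LinearMap.exists_equiv_of_surjective (cls k (TopCat.of (Classifying A)) 0)
    (classifyingPeriod A) (Submodule.subtype _) (cls_surjective k _ 0) (fun z => ?_) fun a => ?_
  · rw [cls_eq_zero_iff]
    constructor
    · intro h
      exact exists_bdry_of_period_eq_zero (isAddQuotientCoveringMap_proj A) first_vadd k hE hk
        z.1 z.2 h
    · rintro ⟨w, hw⟩
      rw [Submodule.subtype_apply, ← hw]
      exact periodMap_bdry (isAddQuotientCoveringMap_proj A) first_vadd k w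
  · obtain ⟨z, hz, hz'⟩ :=
      exists_cycle_period_eq (isAddQuotientCoveringMap_proj A) first_vadd k a
    exact ⟨⟨z, hz⟩, hz'⟩

/-- The first homology of the classifying space of a vector space over a rigid field. -/
def classifyingIso (hk : AdditivelyRigid k) : classifyingFunctor k ⋙ singH k 1 ≅ 𝟭 _ :=
  NatIso.ofComponents (fun A => (exists_classifying_equiv hk A).choose.toModuleIso)
    fun {A A'} φ => by
      ext y
      obtain ⟨z, rfl⟩ := cls_surjective k (TopCat.of (Classifying A)) 0 y
      have hA := (exists_classifying_equiv hk A).choose_spec z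
      change (exists_classifying_equiv hk A').choose
        (((singH k 1).map ((classifyingFunctor k).map φ)).hom _) =
          φ.hom ((exists_classifying_equiv hk A).choose _)
      rw [hA]
      refine (congrArg _ (cls_naturality k ((classifyingFunctor k).map φ) 0 z)).trans ?_
      refine ((exists_classifying_equiv hk A').choose_spec _).trans ?_
      exact classifyingPeriod_naturality φ z.1

/-- A functor from vector spaces to spaces that is a section of the `i`-th homology. -/
theorem exists_moore_functor (hk : AdditivelyRigid k) (n : ℕ) :
    ∃ F : ModuleCat.{0} k ⥤ TopCat.{0}, Nonempty (F ⋙ singH k (n + 1) ≅ 𝟭 _) := by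
  induction n with
  | zero => exact ⟨classifyingFunctor k, ⟨classifyingIso hk⟩⟩
  | succ n ih =>
    obtain ⟨F, ⟨e⟩⟩ := ih
    exact ⟨F ⋙ suspFunctor, ⟨(Functor.isoWhiskerLeft F (suspIso k n)).symm ≪≫ e⟩⟩

end

end SingularChains

/-! ### The total space of a diagram and its sublevel sets. -/

namespace Persistence

open SingularChains

section

variable {P : Type} [Preorder P] (Z : P ⥤ TopCat.{0})

/-- The disjoint union of the spaces of a diagram over a preorder, with the topology in which
every point specializes from its images under the transition maps: a model of the homotopy
colimit. -/
def SpecializationColim : Type := Σ p, Z.obj p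

namespace SpecializationColim

instance : TopologicalSpace (SpecializationColim Z) where
  IsOpen U := (∀ p, IsOpen {x : Z.obj p | (⟨p, x⟩ : Σ p, Z.obj p) ∈ U}) ∧
    ∀ (p q : P) (h : p ≤ q) (x : Z.obj p),
      (⟨q, Z.map (homOfLE h) x⟩ : Σ p, Z.obj p) ∈ U → (⟨p, x⟩ : Σ p, Z.obj p) ∈ U
  isOpen_univ := ⟨fun _ => isOpen_univ, fun _ _ _ _ _ => trivial⟩
  isOpen_inter _ _ hU hV := ⟨fun p => (hU.1 p).inter (hV.1 p),
    fun p q h x hx => ⟨hU.2 p q h x hx.1, hV.2 p q h x hx.2⟩⟩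
  isOpen_sUnion S hS := by
    refine ⟨fun p => ?_, fun p q h x ⟨U, hU, hx⟩ => ⟨U, hU, (hS U hU).2 p q h x hx⟩⟩
    have : {x : Z.obj p | (⟨p, x⟩ : Σ p, Z.obj p) ∈ ⋃₀ S} =
        ⋃ U ∈ S, {x : Z.obj p | (⟨p, x⟩ : Σ p, Z.obj p) ∈ U} := by
      ext x
      simp only [Set.mem_iUnion, exists_prop]
      rfl
    rw [this]
    exact isOpen_biUnion fun U hU => (hS U hU).1 p

variable {Z}

/-- A point of the total space. -/
def mk (p : P) (x : Z.obj p) : SpecializationColim Z := ⟨p, x⟩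

theorem isOpen_iff {U : Set (SpecializationColim Z)} :
    IsOpen U ↔ (∀ p, IsOpen (mk (Z := Z) p ⁻¹' U)) ∧
      ∀ (p q : P) (h : p ≤ q) (x : Z.obj p), mk q (Z.map (homOfLE h) x) ∈ U → mk p x ∈ U :=
  Iff.rfl

theorem continuous_mk (p : P) : Continuous (mk (Z := Z) p) :=
  ⟨fun _ hU => (isOpen_iff.1 hU).1 p⟩

/-- The retraction of the part of the total space below `q` to the space at `q`. -/
def retraction (q : P) : C({y : SpecializationColim Z // y.1 ≤ q}, Z.obj q) where
  toFun y := Z.map (homOfLE y.2) y.1.2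
  continuous_toFun := by
    -- The preimage of `V` is cut out by an open set of the whole total space; functoriality of `Z`
    -- gives its closure under specialization.
    refine ⟨fun V hV => ⟨{y | ∃ h : y.1 ≤ q, Z.map (homOfLE h) y.2 ∈ V}, ?_, ?_⟩⟩
    · refine isOpen_iff.2 ⟨fun p => ?_, ?_⟩
      · by_cases h : p ≤ q
        · convert hV.preimage (Z.map (homOfLE h)).hom.continuous using 1
          ext x
          exact ⟨fun ⟨_, hx⟩ => hx, fun hx => ⟨h, hx⟩⟩
        · convert isOpen_empty using 1
          exact Set.eq_empty_of_forall_notMem fun x hx => h hx.1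
      · rintro p p' h x ⟨h', hx⟩
        refine ⟨h.trans h', ?_⟩
        have := ConcreteCategory.congr_hom (Z.map_comp (homOfLE h) (homOfLE h')) x
        exact this ▸ hx
    · ext y
      exact ⟨fun ⟨_, hy⟩ => hy, fun hy => ⟨y.2, hy⟩⟩

/-- The inclusion of the space at `q`. -/
def incl (q : P) : C(Z.obj q, {y : SpecializationColim Z // y.1 ≤ q}) where
  toFun x := ⟨mk q x, le_rfl⟩
  continuous_toFun := (continuous_mk q).subtype_mk _

theorem retraction_comp_incl (q : P) :
    (retraction (Z := Z) q).comp (incl q) = ContinuousMap.id _ := by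
  ext x
  exact ConcreteCategory.congr_hom (Z.map_id q) x

/-- By the choice of topology, an open set containing the image of `y` at `q` contains `y`. -/
theorem incl_comp_retraction_homotopic (q : P) :
    (ContinuousMap.id _).Homotopic ((incl (Z := Z) q).comp (retraction q)) := by
  refine ContinuousMap.homotopic_of_specializes _ _ fun U hU y hy => ?_
  obtain ⟨V, hV, rfl⟩ := hU
  exact (isOpen_iff.1 hV).2 y.1.1 q y.2 y.1.2 hy

end SpecializationColim

theorem singH_map_eq_of_homotopic (k : Type) [Field k] (i : ℕ) {X Y : TopCat.{0}} (f g : X ⟶ Y)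
    (h : f.hom.Homotopic g.hom) : (singH k i).map f = (singH k i).map g := by
  obtain ⟨H⟩ := h
  exact TopCat.Homotopy.congr_homologyMap_singularChainComplexFunctor H (ModuleCat.of k k) i

open SpecializationColim

variable {Z} {n : ℕ} (γ : SpecializationColim Z → Fin n → ℝ) (J : Grade n ⥤ P)
  (hγ : ∀ y a, (∀ j, γ y j ≤ a j) ↔ y.1 ≤ J.obj a)

-- By `hγ`, the sublevel set at `a` is the part of the total space below `J.obj a`, which deforms
-- onto the space there.
include hγ in
theorem nonempty_sublevelHomology_iso (k : Type) [Field k] (i : ℕ) :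
    Nonempty (sublevelHomology k i (SpecializationColim Z) γ ≅ J ⋙ Z ⋙ singH k i) := by
  let u (a : Grade n) : C({y // ∀ j, γ y j ≤ a j}, {y : SpecializationColim Z // y.1 ≤ J.obj a}) :=
    ⟨fun y => ⟨y.1, (hγ _ _).1 y.2⟩, continuous_subtype_val.subtype_mk _⟩
  let v (a : Grade n) : C({y : SpecializationColim Z // y.1 ≤ J.obj a}, {y // ∀ j, γ y j ≤ a j}) :=
    ⟨fun y => ⟨y.1, (hγ _ _).2 y.2⟩, continuous_subtype_val.subtype_mk _⟩
  let r : sublevelFiltration (SpecializationColim Z) γ ⟶ J ⋙ Z :=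
    { app a := TopCat.ofHom ((retraction (J.obj a)).comp (u a))
      naturality a b h := by
        ext y
        exact ConcreteCategory.congr_hom
          (Z.map_comp (homOfLE ((hγ _ _).1 y.2)) (J.map h)) y.1.2 }
  -- Only the retractions are strictly natural in `a`. The inclusions serve merely as pointwise
  -- inverses after passing to homology.
  have (a : Grade n) : IsIso ((singH k i).map (r.app a)) := by
    let s : TopCat.of (Z.obj (J.obj a)) ⟶ (sublevelFiltration (SpecializationColim Z) γ).obj a :=
      TopCat.ofHom ((v a).comp (incl (J.obj a)))
    refine ⟨(singH k i).map s, ?_, ?_⟩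
    · rw [← Functor.map_comp]
      refine (singH_map_eq_of_homotopic k i (𝟙 _) _ ?_).symm.trans ((singH k i).map_id _)
      exact ContinuousMap.Homotopic.comp (.refl (v a))
        ((incl_comp_retraction_homotopic (J.obj a)).comp (.refl (u a)))
    · rw [← Functor.map_comp]
      refine (congrArg (singH k i).map ?_).trans ((singH k i).map_id _)
      ext x
      exact DFunLike.congr_fun (retraction_comp_incl (J.obj a)) x
  have : IsIso (Functor.whiskerRight r (singH k i)) := by
    rw [NatTrans.isIso_iff_isIso_app]
    exact this
  let e : sublevelFiltration (SpecializationColim Z) γ ⋙ singH k i ≅ (J ⋙ Z) ⋙ singH k i :=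
    asIso (Functor.whiskerRight r (singH k i))
  exact ⟨e⟩

end

/-! ### Interleavings as diagrams on two copies of `ℝⁿ`. -/

/-- Two copies of the poset `ℝⁿ` glued along the relations `a ≤ b` for `a + (ε, …, ε) ≤ b`
with `a` and `b` in different copies. -/
def InterleavingPoset (n : ℕ) (_ : ℝ≥0) : Type := Grade n ⊕ Grade n

namespace InterleavingPoset

variable {n : ℕ} {ε : ℝ≥0}

/-- The order relation. -/
def Rel : Grade n ⊕ Grade n → Grade n ⊕ Grade n → Prop
  | .inl a, .inl b => a ≤ b
  | .inl a, .inr b => (translation n ε).obj a ≤ b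
  | .inr a, .inl b => (translation n ε).obj a ≤ b
  | .inr a, .inr b => a ≤ b

/-- Antisymmetry fails for `ε = 0`, where corresponding points of the two copies lie below each
other. -/
instance : Preorder (InterleavingPoset n ε) where
  le := Rel (ε := ε)
  le_refl x := by
    cases x <;> exact le_refl (α := Grade n) _
  le_trans x y z h h' := by
    rcases x with a | a <;> rcases y with b | b <;> rcases z with c | c
    · exact le_trans (α := Grade n) h h'
    · exact le_trans (α := Grade n) (leOfHom ((translation n ε).map (homOfLE h))) h'
    · exact (le_translation ε a).trans (le_trans (α := Grade n) h ((le_translation ε b).trans h'))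
    · exact le_trans (α := Grade n) h h'
    · exact le_trans (α := Grade n) h h'
    · exact (le_translation ε a).trans (le_trans (α := Grade n) h ((le_translation ε b).trans h'))
    · exact le_trans (α := Grade n) (leOfHom ((translation n ε).map (homOfLE h))) h'
    · exact le_trans (α := Grade n) h h'

/-- The inclusion of the first copy. -/
def left : Grade n ⥤ InterleavingPoset n ε :=
  Monotone.functor (f := (Sum.inl : Grade n → Grade n ⊕ Grade n)) fun _ _ h => h

/-- The inclusion of the second copy. -/
def right : Grade n ⥤ InterleavingPoset n ε :=
  Monotone.functor (f := (Sum.inr : Grade n → Grade n ⊕ Grade n)) fun _ _ h => h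

/-- The grade from which on an element lies below the elements of the first copy. -/
def leftGrade : InterleavingPoset n ε → Grade n
  | .inl a => a
  | .inr a => (translation n ε).obj a

/-- The grade from which on an element lies below the elements of the second copy. -/
def rightGrade : InterleavingPoset n ε → Grade n
  | .inl a => (translation n ε).obj a
  | .inr a => a

/-- With `rightGrade_le_iff`, the hypothesis `hγ` of `nonempty_sublevelHomology_iso` for the two
functions. -/
theorem leftGrade_le_iff (x : InterleavingPoset n ε) (a : Grade n) :
    leftGrade x ≤ a ↔ x ≤ left.obj a := by
  cases x <;> rfl

theorem rightGrade_le_iff (x : InterleavingPoset n ε) (a : Grade n) :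
    rightGrade x ≤ a ↔ x ≤ right.obj a := by
  cases x <;> rfl

theorem edist_leftGrade_rightGrade_le (x : InterleavingPoset n ε) :
    edist (α := Fin n → ℝ) (leftGrade x) (rightGrade x) ≤ ε := by
  refine edist_pi_le_iff.2 fun j => ?_
  rw [edist_le_coe, ← NNReal.coe_le_coe, coe_nndist, Real.dist_eq]
  rcases x with a | a
  · change |a j - (a j + ε)| ≤ ε
    simp
  · change |(a j + ε) - a j| ≤ ε
    simp

variable {k : Type} [Field k] {M N : NMod k n} (f : M ⟶ N.shift ε) (g : N ⟶ M.shift ε)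

/-- The object part of the diagram of an interleaving. -/
def glueObj (M N : NMod k n) : Grade n ⊕ Grade n → ModuleCat.{0} k
  | .inl a => M.obj a
  | .inr a => N.obj a

/-- The morphism part of the diagram of an interleaving. -/
def glueMap : ∀ x y : Grade n ⊕ Grade n, Rel (ε := ε) x y → (glueObj M N x ⟶ glueObj M N y)
  | .inl _, .inl _, h => M.map (homOfLE h)
  | .inl a, .inr _, h => f.app a ≫ N.map (homOfLE h)
  | .inr a, .inl _, h => g.app a ≫ M.map (homOfLE h)
  | .inr _, .inr _, h => N.map (homOfLE h)

/-- The diagram of an interleaving. -/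
def glue (hfg : ∀ a : Grade n, f.app a ≫ g.app ((translation n ε).obj a) =
      M.map (homOfLE ((le_translation ε a).trans (le_translation ε _))))
    (hgf : ∀ a : Grade n, g.app a ≫ f.app ((translation n ε).obj a) =
      N.map (homOfLE ((le_translation ε a).trans (le_translation ε _)))) :
    InterleavingPoset n ε ⥤ ModuleCat.{0} k where
  obj := glueObj M N
  map {x y} h := glueMap f g x y (leOfHom h)
  map_id x := by
    cases x
    · exact M.map_id _
    · exact N.map_id _
  map_comp {x y z} h h' := by
    have hf {a b : Grade n} (h : a ≤ b) :
        M.map (homOfLE h) ≫ f.app b = f.app a ≫ N.map ((translation n ε).map (homOfLE h)) :=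
      f.naturality (homOfLE h)
    have hg {a b : Grade n} (h : a ≤ b) :
        N.map (homOfLE h) ≫ g.app b = g.app a ≫ M.map ((translation n ε).map (homOfLE h)) :=
      g.naturality (homOfLE h)
    rcases x with a | a <;> rcases y with b | b <;> rcases z with c | c
    · exact M.map_comp (homOfLE _) (homOfLE _)
    · change f.app a ≫ N.map _ = M.map (homOfLE _) ≫ f.app b ≫ N.map _
      rw [reassoc_of% (hf (leOfHom h)), ← N.map_comp]
      rfl
    -- Crossing over and back: naturality of `g` makes `f` and `g` adjacent, and the interleaving
    -- identity merges them into a transition map.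
    · change M.map _ = (f.app a ≫ N.map (homOfLE _)) ≫ g.app b ≫ M.map _
      rw [Category.assoc, reassoc_of% (hg (leOfHom h)), reassoc_of% (hfg a), ← M.map_comp,
        ← M.map_comp]
      rfl
    · change f.app a ≫ N.map _ = (f.app a ≫ N.map _) ≫ N.map _
      rw [Category.assoc, ← N.map_comp]
      rfl
    · change g.app a ≫ M.map _ = (g.app a ≫ M.map _) ≫ M.map _
      rw [Category.assoc, ← M.map_comp]
      rfl
    · change N.map _ = (g.app a ≫ M.map (homOfLE _)) ≫ f.app b ≫ N.map _
      rw [Category.assoc, reassoc_of% (hf (leOfHom h)), reassoc_of% (hgf a), ← N.map_comp,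
        ← N.map_comp]
      rfl
    · change g.app a ≫ M.map _ = N.map (homOfLE _) ≫ g.app b ≫ M.map _
      rw [reassoc_of% (hg (leOfHom h)), ← M.map_comp]
      rfl
    · exact N.map_comp (homOfLE _) (homOfLE _)

end InterleavingPoset

/-! ### Realization, maximality, the pseudometric axioms and stability. -/

open InterleavingPoset

variable {k : Type} [Field k] {n : ℕ}

/-- Interleaved modules are the homology modules of functions at distance at most `ε`. -/
theorem Interleaved.exists_sublevelHomology_iso (hk : AdditivelyRigid k) {ε : ℝ≥0} {M N : NMod k n}
    (h : Interleaved ε M N) (i : ℕ) :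
    ∃ (X : Type) (_ : TopologicalSpace X) (γ₁ γ₂ : X → Fin n → ℝ), supDist γ₁ γ₂ ≤ ε ∧
      Nonempty (sublevelHomology k (i + 1) X γ₁ ≅ M) ∧
      Nonempty (sublevelHomology k (i + 1) X γ₂ ≅ N) := by
  obtain ⟨f, g, hfg, hgf⟩ := h
  obtain ⟨F, ⟨e⟩⟩ := exists_moore_functor hk i
  let Z := glue f g hfg hgf ⋙ F
  obtain ⟨e₁⟩ := nonempty_sublevelHomology_iso (Z := Z) (fun y => leftGrade y.1) left
    (fun y a => leftGrade_le_iff y.1 a) k (i + 1)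
  obtain ⟨e₂⟩ := nonempty_sublevelHomology_iso (Z := Z) (fun y => rightGrade y.1) right
    (fun y a => rightGrade_le_iff y.1 a) k (i + 1)
  refine ⟨SpecializationColim Z, inferInstance, fun y => leftGrade y.1, fun y => rightGrade y.1,
    iSup_le fun y => edist_leftGrade_rightGrade_le y.1,
    ⟨e₁ ≪≫ Functor.isoWhiskerLeft (left ⋙ glue f g hfg hgf) e ≪≫ NatIso.ofComponents
      (fun a => Iso.refl (M.obj a)) fun h => ?_⟩,
    ⟨e₂ ≪≫ Functor.isoWhiskerLeft (right ⋙ glue f g hfg hgf) e ≪≫ NatIso.ofComponents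
      (fun a => Iso.refl (N.obj a)) fun h => ?_⟩⟩
  · exact (Category.comp_id _).trans (Category.id_comp _).symm
  · exact (Category.comp_id _).trans (Category.id_comp _).symm

theorem le_interleavingDist_of_isStable (hk : AdditivelyRigid k) {i : ℕ}
    {d : NModClass k n → NModClass k n → ℝ≥0∞} (hd : IsStable k n (i + 1) d)
    (x y : NModClass k n) : d x y ≤ interleavingDist k n x y := by
  induction x, y using Quotient.inductionOn₂ with | _ M N
  refine le_iInf₂ fun ε h => ?_
  obtain ⟨X, _, γ₁, γ₂, hγ, e₁, e₂⟩ := h.exists_sublevelHomology_iso hk i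
  have h₁ : (sublevelHomology k (i + 1) X γ₁).cls = ⟦M⟧ := Quotient.sound e₁
  have h₂ : (sublevelHomology k (i + 1) X γ₂).cls = ⟦N⟧ := Quotient.sound e₂
  exact h₁ ▸ h₂ ▸ (hd X γ₁ γ₂).trans hγ

theorem Interleaved.refl (M : NMod k n) : Interleaved 0 M M := by
  have h (a : Grade n) : a ≤ (translation n 0).obj a := le_translation 0 a
  let u : M ⟶ M.shift 0 :=
    { app a := M.map (homOfLE (h a))
      naturality a b l := (M.map_comp l (homOfLE (h b))).symm.trans
        (M.map_comp (homOfLE (h a)) ((translation n 0).map l)) }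
  exact ⟨u, u, fun a => (M.map_comp _ _).symm, fun a => (M.map_comp _ _).symm⟩

theorem Interleaved.symm {ε : ℝ≥0} {M N : NMod k n} : Interleaved ε M N → Interleaved ε N M :=
  fun ⟨f, g, hfg, hgf⟩ => ⟨g, f, hgf, hfg⟩

theorem translation_translation_obj (ε δ : ℝ≥0) (a : Grade n) :
    (translation n δ).obj ((translation n ε).obj a) = (translation n (ε + δ)).obj a := by
  funext j
  change a j + ε + δ = a j + ↑(ε + δ)
  rw [NNReal.coe_add, add_assoc]

/-- The composite of morphisms to shifted modules. -/
def shiftComp {ε δ : ℝ≥0} {L M N : NMod k n} (f : L ⟶ M.shift ε) (g : M ⟶ N.shift δ)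
    (η : ℝ≥0) (h : ∀ a : Grade n, (translation n δ).obj ((translation n ε).obj a) =
      (translation n η).obj a) : L ⟶ N.shift η where
  app a := f.app a ≫ g.app _ ≫ N.map (homOfLE (h a).le)
  naturality a b l := by
    have hf : L.map l ≫ f.app b = f.app a ≫ M.map ((translation n ε).map l) := f.naturality l
    have hg : M.map ((translation n ε).map l) ≫ g.app _ =
      g.app _ ≫ N.map ((translation n δ).map ((translation n ε).map l)) := g.naturality _
    change _ = (_ ≫ _ ≫ N.map (homOfLE (h a).le)) ≫ N.map ((translation n η).map l)
    rw [reassoc_of% hf, reassoc_of% hg, Category.assoc, Category.assoc, ← N.map_comp,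
      ← N.map_comp]
    rfl

/-- The inner pair `f'`, `g'` contracts to a transition map of `M`, which moves past `g` by
naturality; then `f` and `g` contract. -/
theorem shiftComp_shiftComp {ε δ η : ℝ≥0} {L M N : NMod k n}
    {f : L ⟶ M.shift ε} {g : M ⟶ L.shift ε} {f' : M ⟶ N.shift δ} {g' : N ⟶ M.shift δ}
    (h : ∀ a : Grade n, f.app a ≫ g.app ((translation n ε).obj a) =
      L.map (homOfLE ((le_translation ε a).trans (le_translation ε _))))
    (h' : ∀ a : Grade n, f'.app a ≫ g'.app ((translation n δ).obj a) =
      M.map (homOfLE ((le_translation δ a).trans (le_translation δ _))))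
    (e e') (a : Grade n) :
    (shiftComp f f' η e).app a ≫ (shiftComp g' g η e').app ((translation n η).obj a) =
      L.map (homOfLE ((le_translation η a).trans (le_translation η _))) := by
  have hg {b c : Grade n} (l : b ⟶ c) :
      M.map l ≫ g.app c = g.app b ≫ L.map ((translation n ε).map l) := g.naturality l
  have hg' {b c : Grade n} (l : b ⟶ c) :
      N.map l ≫ g'.app c = g'.app b ≫ M.map ((translation n δ).map l) := g'.naturality l
  change (f.app a ≫ f'.app _ ≫ N.map (homOfLE (e a).le)) ≫ g'.app _ ≫ g.app _ ≫
    L.map (homOfLE (e' _).le) = _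
  simp only [Category.assoc]
  rw [reassoc_of% (hg' (homOfLE (e a).le)), reassoc_of% (h' ((translation n ε).obj a)),
    reassoc_of% (hg ((translation n δ).map (homOfLE (e a).le))), reassoc_of% (hg (homOfLE _)),
    reassoc_of% (h a), ← L.map_comp, ← L.map_comp, ← L.map_comp]
  rfl

theorem Interleaved.trans {ε δ : ℝ≥0} {L M N : NMod k n} (h : Interleaved ε L M)
    (h' : Interleaved δ M N) : Interleaved (ε + δ) L N := by
  obtain ⟨f, g, hfg, hgf⟩ := h
  obtain ⟨f', g', hfg', hgf'⟩ := h'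
  have e (a : Grade n) := translation_translation_obj ε δ a
  have e' (a : Grade n) := (translation_translation_obj δ ε a).trans (by rw [add_comm])
  exact ⟨shiftComp f f' _ e, shiftComp g' g _ e', shiftComp_shiftComp hfg hfg' e e',
    shiftComp_shiftComp hgf' hgf e' e⟩

theorem interleavingDistMod_symm (M N : NMod k n) :
    interleavingDistMod M N = interleavingDistMod N M := by
  have (ε : ℝ≥0) : Interleaved ε M N ↔ Interleaved ε N M := ⟨.symm, .symm⟩
  simp only [interleavingDistMod, this]

theorem isExtPseudometric_interleavingDist : IsExtPseudometric (interleavingDist k n) where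
  self x := by
    induction x using Quotient.inductionOn with | _ M
    exact le_antisymm (iInf₂_le_of_le 0 (.refl M) le_rfl) bot_le
  symm x y := by
    induction x, y using Quotient.inductionOn₂ with | _ M N
    exact interleavingDistMod_symm M N
  triangle x y z := by
    induction x, y, z using Quotient.inductionOn₃ with | _ L M N
    change interleavingDistMod L N ≤ interleavingDistMod L M + interleavingDistMod M N
    refine ENNReal.le_iInf₂_add_iInf₂ fun ε h δ h' => ?_
    exact iInf₂_le_of_le (ε + δ) (h.trans h') (ENNReal.coe_add ε δ).le

/-- The interleaving exists already for the filtrations by spaces, where both composites are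
literally inclusions. -/
theorem interleaved_sublevelHomology (i : ℕ) (X : Type) [TopologicalSpace X]
    (γ₁ γ₂ : X → Fin n → ℝ) (ε : ℝ≥0) (h : ∀ x, edist (γ₁ x) (γ₂ x) ≤ ε) :
    Interleaved ε (sublevelHomology k i X γ₁) (sublevelHomology k i X γ₂) := by
  have key (γ₁ γ₂ : X → Fin n → ℝ) (h : ∀ x, edist (γ₁ x) (γ₂ x) ≤ ε) (x : X) (a : Grade n)
      (hx : ∀ j, γ₁ x j ≤ a j) (j : Fin n) : γ₂ x j ≤ (translation n ε).obj a j := by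
    have h1 := edist_pi_le_iff.1 (h x) j
    rw [edist_le_coe, ← NNReal.coe_le_coe, coe_nndist, Real.dist_eq, abs_le] at h1
    change _ ≤ a j + ε
    linarith [hx j]
  let u (γ₁ γ₂ : X → Fin n → ℝ) (h : ∀ x, edist (γ₁ x) (γ₂ x) ≤ ε) :
      sublevelFiltration X γ₁ ⟶ translation n ε ⋙ sublevelFiltration X γ₂ :=
    { app a := TopCat.ofHom
        ⟨fun x => ⟨x.1, key γ₁ γ₂ h x.1 a x.2⟩, continuous_subtype_val.subtype_mk _⟩
      naturality _ _ _ := rfl }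
  have h' (x : X) : edist (γ₂ x) (γ₁ x) ≤ ε := edist_comm (γ₁ x) (γ₂ x) ▸ h x
  refine ⟨Functor.whiskerRight (u γ₁ γ₂ h) (singH k i),
    Functor.whiskerRight (u γ₂ γ₁ h') (singH k i), fun a => ?_, fun a => ?_⟩
  · exact ((singH k i).map_comp ((u γ₁ γ₂ h).app a) ((u γ₂ γ₁ h').app _)).symm
  · exact ((singH k i).map_comp ((u γ₂ γ₁ h').app a) ((u γ₁ γ₂ h).app _)).symm

theorem isStable_interleavingDist (i : ℕ) : IsStable k n i (interleavingDist k n) := by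
  intro X _ γ₁ γ₂
  cases hε : supDist γ₁ γ₂ with
  | top => exact le_top
  | coe ε =>
    exact iInf₂_le ε (interleaved_sublevelHomology i X γ₁ γ₂ ε
      fun x => (le_iSup (fun x => edist (γ₁ x) (γ₂ x)) x).trans hε.le)

theorem isOptimal_interleavingDist (hk : AdditivelyRigid k) {i : ℕ} (hi : 1 ≤ i) :
    IsOptimal k n i (interleavingDist k n) where
  pseudometric := isExtPseudometric_interleavingDist
  stable := isStable_interleavingDist i
  maximal d _ hd x y := by
    obtain ⟨i, rfl⟩ := Nat.exists_eq_add_of_le' hi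
    exact le_interleavingDist_of_isStable hk hd x y

end Persistence

end

/-- Both fields are additively rigid, since compatibility with their scalars follows from
compatibility with integer multiples. -/
theorem mainTheorem1 (n i : ℕ) (hi : 1 ≤ i) :
    Persistence.IsOptimal ℚ n i (Persistence.interleavingDist ℚ n) ∧
    ∀ (p : ℕ) [Fact p.Prime],
      Persistence.IsOptimal (ZMod p) n i (Persistence.interleavingDist (ZMod p) n) :=
  ⟨Persistence.isOptimal_interleavingDist (fun _ _ _ _ _ _ f r a => map_rat_smul f r a) hi,
    fun _ _ => Persistence.isOptimal_interleavingDist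
      (fun _ _ _ _ _ _ f r a => ZMod.map_smul f r a) hi⟩
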